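/- Let $K$ be a field of characteristic $0$. A \emph{rigid $K$-category} is a $K$-linear symmetric monoidal category with $K$-bilinear tensor product in which every object $M$ has a dual $M^*$ and $\operatorname{End}(\mathbf 1)=K$. A \emph{tensor functor} is a linear symmetric monoidal functor. The \emph{trace} $\operatorname{tr}(f)\in\operatorname{End}(\mathbf 1)=K$ of $f\in \operatorname{End}(M)$ is the composition $\mathbf 1\xrightarrow{\eta} M^*\otimes M\xrightarrow{1\otimes f}M^*\otimes M\xrightarrow{R} M\otimes M^*\xrightarrow{\varepsilon}\mathbf 1$, where $R$ is the switch and $\eta,\varepsilon$ are the duality morphisms; a morphism $f:M\to N$ is \emph{universally of trace $0$} if $\operatorname{tr}(gf)=0$ for all $g:N\to M$, and $\mathcal N(\mathcal A)$ is the tensor ideal of these morphisms. A semisimple rigid $K$-category $\bar{\mathcal A}$ is \emph{of homological origin} if it is tensor-equivalent to $\mathcal A/\mathcal N(\mathcal A)$ for some rigid $K$-category $\mathcal A$ which admits a ($K$-linear) tensor functor $H:\mathcal A\to \mathrm{Vec}^{\pm}_L$ to the category of finite-dimensional $\mathbf Z/2$-graded vector spaces (with the Koszul sign rule for the commutativity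 constraint) over some field extension $L$ of $K$. An object $M$ is \emph{Schur-finite} if, in the pseudo-abelian hull, $\mathbb S(M)=0$ for the Schur functor $\mathbb S=\operatorname{Hom}_{\mathfrak S_n}(V,(-)^{\otimes n})$ attached to some $n\ge 0$ and some irreducible $K$-representation $V$ of the symmetric group $\mathfrak S_n$. An object $M$ of a semisimple rigid $k$-category is \emph{of integral type} if the unique element $\mu\in\operatorname{End}(M)$ with $\operatorname{tr}(f)=\operatorname{Trd}(\mu f)$ for all $f\in\operatorname{End}(M)$ has an integer as its component in every simple factor of $\operatorname{End}(M)$. Here $\operatorname{Trd}$ is the sum over the simple factors $A_i$ of $\operatorname{End}(M)$, with centres $Z_i$, of the reduced traces $\operatorname{Tr}_{Z_i/k}\circ\operatorname{Trd}_{A_i/Z_i}$. A rigid $K$-category is \emph{geometrically of integral type} if each of its objects becomes of integral type after extension of scalars to an algebraic closure $\bar K$ of $K$ (that is, in the category with the same objects and with morphisms $\bar K\otimes_K\operatorname{Hom}(M,N)$). \textbf{Theorem.} If $\bar{\mathcal A}$ is of homological origin, then every object of $\bar{\mathcal A}$ is Schur-finite. In particular $\bar{\mathcal A}$ is geometrically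 of integral type. -/

import Mathlib

open CategoryTheory MonoidalCategory
universe v u w w' v' u'

noncomputable section

namespace TensorCat

section Trace
variable {C : Type u} [Category.{v} C] [MonoidalCategory C] [SymmetricCategory C]
  [LeftRigidCategory C]

/-- The trace of an endomorphism `f` of `X`: the composition
`𝟙 ⟶ X* ⊗ X ⟶ X* ⊗ X ⟶ X ⊗ X* ⟶ 𝟙` of the coevaluation, `1 ⊗ f`, the switch and the evaluation. -/
def trace {X : C} (f : X ⟶ X) : End (𝟙_ C) :=
  η_ (ᘁX) X ≫ (ᘁX) ◁ f ≫ (β_ (ᘁX) X).hom ≫ ε_ (ᘁX) X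

variable [Preadditive C]

/-- `f : X ⟶ Y` is universally of trace zero if `tr (g ∘ f) = 0` for every `g : Y ⟶ X`. -/
def UniversallyTraceZero {X Y : C} (f : X ⟶ Y) : Prop :=
  ∀ g : Y ⟶ X, trace (f ≫ g) = 0

theorem universallyTraceZero_iff {X Y : C} (f : X ⟶ Y) :
    UniversallyTraceZero f ↔
      ∀ (Z : C) (a : 𝟙_ C ⟶ Z ⊗ X) (b : Z ⊗ Y ⟶ 𝟙_ C), a ≫ Z ◁ f ≫ b = 0 := by
  constructor
  · intro h Z a b
    obtain ⟨a', rfl⟩ := (tensorRightHomEquiv (𝟙_ C) (ᘁX) X Z).surjective a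
    let ψ : Y ⊗ (ᘁX) ⟶ 𝟙_ C := (β_ Y (ᘁX)).hom ≫ ((λ_ _).inv ≫ a') ▷ Y ≫ b
    let g : Y ⟶ X := tensorRightHomEquiv Y (ᘁX) X (𝟙_ C) ψ ≫ (λ_ X).hom
    have hg : g ▷ (ᘁX) ≫ ε_ (ᘁX) X = ψ := by
      have := (tensorRightHomEquiv Y (ᘁX) X (𝟙_ C)).symm_apply_apply ψ
      rw [← this]
      simp [tensorRightHomEquiv, g, -Equiv.symm_apply_apply]
      simp [unitors_inv_equal]
    have h2 := h g
    rw [trace, MonoidalCategory.whiskerLeft_comp, Category.assoc,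
      BraidedCategory.braiding_naturality_right_assoc, hg] at h2
    rw [← h2]
    simp [tensorRightHomEquiv, ψ]
    rw [← whisker_exchange_assoc]
    simp [unitors_equal]
  · intro h g
    have := h (ᘁX) (η_ (ᘁX) X) ((ᘁX) ◁ g ≫ (β_ (ᘁX) X).hom ≫ ε_ (ᘁX) X)
    simpa [trace] using this

end Trace

section Neg
variable {C : Type u} [Category.{v} C] [MonoidalCategory C] [SymmetricCategory C]
  [LeftRigidCategory C] [Preadditive C] [MonoidalPreadditive C]

namespace UniversallyTraceZero

theorem zero (X Y : C) : UniversallyTraceZero (0 : X ⟶ Y) := by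
  simp [universallyTraceZero_iff]

theorem add {X Y : C} {f g : X ⟶ Y} (hf : UniversallyTraceZero f)
    (hg : UniversallyTraceZero g) : UniversallyTraceZero (f + g) := by
  rw [universallyTraceZero_iff] at *
  intro Z a b
  simp [MonoidalPreadditive.whiskerLeft_add, hf, hg]

theorem neg {X Y : C} {f : X ⟶ Y} (hf : UniversallyTraceZero f) :
    UniversallyTraceZero (-f) := by
  rw [universallyTraceZero_iff] at *
  intro Z a b
  have : Z ◁ (-f) = - (Z ◁ f) := (tensorLeft Z).map_neg
  simp [this, hf]

theorem smul {K : Type w} [CommRing K] [Linear K C] [MonoidalLinear K C] {X Y : C} (r : K)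
    {f : X ⟶ Y} (hf : UniversallyTraceZero f) : UniversallyTraceZero (r • f) := by
  rw [universallyTraceZero_iff] at *
  intro Z a b
  simp [hf]

theorem precomp {X Y Z : C} (f : X ⟶ Y) {g : Y ⟶ Z} (hg : UniversallyTraceZero g) :
    UniversallyTraceZero (f ≫ g) := by
  rw [universallyTraceZero_iff] at *
  intro W a b
  simpa using hg W (a ≫ W ◁ f) b

theorem postcomp {X Y Z : C} {f : X ⟶ Y} (g : Y ⟶ Z) (hf : UniversallyTraceZero f) :
    UniversallyTraceZero (f ≫ g) := by
  rw [universallyTraceZero_iff] at *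
  intro W a b
  simpa using hf W a (W ◁ g ≫ b)

theorem whiskerLeft (W : C) {X Y : C} {f : X ⟶ Y} (hf : UniversallyTraceZero f) :
    UniversallyTraceZero (W ◁ f) := by
  rw [universallyTraceZero_iff] at *
  intro Z a b
  simpa using hf (Z ⊗ W) (a ≫ (α_ _ _ _).inv) ((α_ _ _ _).hom ≫ b)

theorem whiskerRight {X Y : C} {f : X ⟶ Y} (hf : UniversallyTraceZero f) (W : C) :
    UniversallyTraceZero (f ▷ W) := by
  have : f ▷ W = (β_ X W).hom ≫ W ◁ f ≫ (β_ W Y).hom := by simp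
  rw [this]
  exact precomp _ (postcomp _ (hf.whiskerLeft W))

end UniversallyTraceZero

variable (C) in
/-- The congruence modulo the ideal of morphisms universally of trace zero. -/
def negRel : HomRel C := fun _ _ f g => UniversallyTraceZero (f - g)

instance : Congruence (negRel C) where
  comp_left f _ _ h := by
    simpa [negRel] using UniversallyTraceZero.precomp f h
  comp_right g h := by
    simpa [negRel] using UniversallyTraceZero.postcomp g h
  equivalence :=
    { refl := fun f => by simpa [negRel] using UniversallyTraceZero.zero _ _
      symm := fun h => by simpa [negRel] using UniversallyTraceZero.neg h
      trans := fun h₁ h₂ => by simpa [negRel] using UniversallyTraceZero.add h₁ h₂ }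

theorem negRel_add ⦃X Y : C⦄ (f₁ f₂ g₁ g₂ : X ⟶ Y) (h₁ : negRel C f₁ f₂)
    (h₂ : negRel C g₁ g₂) : negRel C (f₁ + g₁) (f₂ + g₂) := by
  have := UniversallyTraceZero.add h₁ h₂
  rwa [← add_sub_add_comm] at this

theorem negRel_smul {K : Type w} [CommRing K] [Linear K C] [MonoidalLinear K C] (r : K)
    ⦃X Y : C⦄ (f₁ f₂ : X ⟶ Y) (h : negRel C f₁ f₂) : negRel C (r • f₁) (r • f₂) := by
  have := UniversallyTraceZero.smul r h
  rwa [smul_sub] at this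

variable (C) in
/-- The quotient `C/N` of `C` by the ideal `N` of morphisms universally of trace zero, with the
tensor structure induced by that of `C`. -/
abbrev NumQuotient := CategoryTheory.Quotient (negRel C)

namespace NumQuotient

instance : Preadditive (NumQuotient C) := Quotient.preadditive _ negRel_add

instance : (Quotient.functor (negRel C)).Additive := Quotient.functor_additive _ negRel_add

instance (K : Type w) [CommRing K] [Linear K C] [MonoidalLinear K C] :
    Linear K (NumQuotient C) := Quotient.linear K _ negRel_smul

/-- The projection functor `C ⥤ C/N`. -/
abbrev proj : C ⥤ NumQuotient C := Quotient.functor (negRel C)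

/-- The morphism `1 ⊗ f` of `C/N`. -/
def wL (W : C) {X Y : NumQuotient C} (f : X ⟶ Y) :
    proj.obj (W ⊗ X.as) ⟶ proj.obj (W ⊗ Y.as) :=
  (CategoryTheory.Quotient.lift (negRel C) (tensorLeft W ⋙ proj) (by
    intro X Y f g h
    apply CategoryTheory.Quotient.sound
    have := UniversallyTraceZero.whiskerLeft W h
    have e : W ◁ (f - g) = W ◁ f - W ◁ g := (tensorLeft W).map_sub
    rwa [e] at this)).map f

/-- The morphism `f ⊗ 1` of `C/N`. -/
def wR {X Y : NumQuotient C} (f : X ⟶ Y) (W : C) :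
    proj.obj (X.as ⊗ W) ⟶ proj.obj (Y.as ⊗ W) :=
  (CategoryTheory.Quotient.lift (negRel C) (tensorRight W ⋙ proj) (by
    intro X Y f g h
    apply CategoryTheory.Quotient.sound
    have := UniversallyTraceZero.whiskerRight h W
    have e : (f - g) ▷ W = f ▷ W - g ▷ W := (tensorRight W).map_sub
    rwa [e] at this)).map f

instance : MonoidalCategoryStruct (NumQuotient C) where
  tensorObj X Y := proj.obj (X.as ⊗ Y.as)
  tensorUnit := proj.obj (𝟙_ C)
  whiskerLeft X _ _ f := wL X.as f
  whiskerRight f X := wR f X.as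
  tensorHom {_ Y₁ X₂ _} f g := wR f X₂.as ≫ wL Y₁.as g
  associator X Y Z := proj.mapIso (α_ X.as Y.as Z.as)
  leftUnitor X := proj.mapIso (λ_ X.as)
  rightUnitor X := proj.mapIso (ρ_ X.as)

theorem proj_whiskerLeft (W : C) {X Y : C} (f : X ⟶ Y) :
  (proj.obj W) ◁ (proj.map f) = proj.map (W ◁ f) := rfl
theorem proj_whiskerRight (W : C) {X Y : C} (f : X ⟶ Y) :
  (proj.map f) ▷ (proj.obj W) = proj.map (f ▷ W) := rfl
theorem proj_tensorHom {X Y X' Y' : C} (f : X ⟶ Y) (f' : X' ⟶ Y') :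
   proj.map f ⊗ₘ proj.map f' = proj.map (f ⊗ₘ f') := by
  rw [MonoidalCategory.tensorHom_def, Functor.map_comp]; rfl

instance : MonoidalCategory (NumQuotient C) where
  tensorHom_def _ _ := rfl
  id_tensorHom_id X Y := by
    have := proj_tensorHom (𝟙 X.as) (𝟙 Y.as)
    simpa using! this
  tensorHom_comp_tensorHom := by
    rintro _ _ _ _ _ _ ⟨f⟩ ⟨g⟩ ⟨h⟩ ⟨k⟩
    exact congrArg proj.map (show (f ▷ _ ≫ _ ◁ g) ≫ (h ▷ _ ≫ _ ◁ k) =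
      (f ≫ h) ▷ _ ≫ _ ◁ (g ≫ k) by simp [whisker_exchange_assoc])
  whiskerLeft_id X Y := congrArg proj.map (MonoidalCategory.whiskerLeft_id X.as Y.as)
  id_whiskerRight X Y := congrArg proj.map (MonoidalCategory.id_whiskerRight X.as Y.as)
  associator_naturality := by
    rintro _ _ _ _ _ _ ⟨f⟩ ⟨g⟩ ⟨h⟩
    exact congrArg proj.map (show (((f ▷ _ ≫ _ ◁ g) ▷ _) ≫ _ ◁ h) ≫ (α_ _ _ _).hom =
      (α_ _ _ _).hom ≫ f ▷ _ ≫ _ ◁ (g ▷ _ ≫ _ ◁ h) by simp)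
  leftUnitor_naturality := by
    rintro _ _ ⟨f⟩
    exact congrArg proj.map (MonoidalCategory.leftUnitor_naturality f)
  rightUnitor_naturality := by
    rintro _ _ ⟨f⟩
    exact congrArg proj.map (MonoidalCategory.rightUnitor_naturality f)
  pentagon W X Y Z := congrArg proj.map (MonoidalCategory.pentagon W.as X.as Y.as Z.as)
  triangle X Y := congrArg proj.map (MonoidalCategory.triangle X.as Y.as)

instance : SymmetricCategory (NumQuotient C) where
  braiding X Y := proj.mapIso (β_ X.as Y.as)
  braiding_naturality_right := by
    rintro X _ _ ⟨f⟩
    exact congrArg proj.map (BraidedCategory.braiding_naturality_right X.as f)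
  braiding_naturality_left := by
    rintro _ _ ⟨f⟩ X
    exact congrArg proj.map (BraidedCategory.braiding_naturality_left f X.as)
  hexagon_forward X Y Z :=
    congrArg proj.map (BraidedCategory.hexagon_forward X.as Y.as Z.as)
  hexagon_reverse X Y Z :=
    congrArg proj.map (BraidedCategory.hexagon_reverse X.as Y.as Z.as)
  symmetry X Y :=
    congrArg proj.map (SymmetricCategory.symmetry X.as Y.as)

end NumQuotient
end Neg

section Perm
open Equiv

/-- The permutation `σ'` with `σ (j + 1) = (σ 0).succAbove (σ' j)`. -/
theorem exists_reduced {n : ℕ} (σ : Perm (Fin (n + 2))) :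
    ∃ σ' : Perm (Fin (n + 1)), ∀ j, σ j.succ = (σ 0).succAbove (σ' j) := by
  refine ⟨((finSuccAboveEquiv 0).trans
    (σ.subtypeEquiv (fun a => by simp))).trans
      (finSuccAboveEquiv (σ 0)).symm, fun j => ?_⟩
  have := congrArg Subtype.val ((finSuccAboveEquiv (σ 0)).apply_symm_apply
    ((((finSuccAboveEquiv 0).trans
    (σ.subtypeEquiv (q := fun x => x ≠ σ 0) (fun a => by simp))) j)))
  exact this.symm

theorem reduced_unique {n : ℕ} {σ : Perm (Fin (n + 2))} {τ τ' : Perm (Fin (n + 1))}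
    (h : ∀ j, σ j.succ = (σ 0).succAbove (τ j)) (h' : ∀ j, σ j.succ = (σ 0).succAbove (τ' j)) :
    τ = τ' :=
  Equiv.ext fun j => Fin.succAbove_right_injective ((h j).symm.trans (h' j))

theorem succAbove_swap_same {n : ℕ} (i : Fin (n + 1)) (p : Fin (n + 2))
    (hp : p = i.castSucc ∨ p = i.succ) (x : Fin (n + 1)) :
    swap i.castSucc i.succ (p.succAbove x) = (swap i.castSucc i.succ p).succAbove x := by
  rcases hp with rfl | rfl <;>
    simp only [swap_apply_left, swap_apply_right, Fin.succAbove, swap_apply_def, Fin.ext_iff, Fin.lt_def] <;>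
    split_ifs <;> simp_all <;> omega

theorem succAbove_swap_lt {n : ℕ} (i : Fin n) (p : Fin (n + 2))
    (hp : (p : ℕ) < i + 1) (x : Fin (n + 1)) :
    swap i.succ.castSucc i.succ.succ (p.succAbove x) =
      (swap i.succ.castSucc i.succ.succ p).succAbove (swap i.castSucc i.succ x) := by
  simp only [Fin.succAbove, swap_apply_def, Fin.ext_iff, Fin.lt_def, Fin.val_castSucc,
    Fin.val_succ]
  split_ifs <;> simp only [Fin.ext_iff, Fin.val_castSucc, Fin.val_succ] at * <;> omega

theorem succAbove_swap_gt {n : ℕ} (i : Fin n) (p : Fin (n + 2))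
    (hp : (i : ℕ) + 1 < p) (x : Fin (n + 1)) :
    swap i.castSucc.castSucc i.castSucc.succ (p.succAbove x) =
      (swap i.castSucc.castSucc i.castSucc.succ p).succAbove (swap i.castSucc i.succ x) := by
  simp only [Fin.succAbove, swap_apply_def, Fin.ext_iff, Fin.lt_def, Fin.val_castSucc,
    Fin.val_succ]
  split_ifs <;> simp only [Fin.ext_iff, Fin.val_castSucc, Fin.val_succ] at * <;> omega

/-- The product `s (k - 1) ⋯ s 1 s 0`. -/
def cyc {E : Type*} [Monoid E] (s : ℕ → E) : ℕ → E
  | 0 => 1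
  | k + 1 => s k * cyc s k

theorem exists_perm_hom (n : ℕ) {E : Type*} [Monoid E] (s : ℕ → E)
    (sq : ∀ i < n, s i * s i = 1)
    (braid : ∀ i, i + 1 < n → s i * s (i + 1) * s i = s (i + 1) * s i * s (i + 1))
    (comm : ∀ i j, i + 1 < j → j < n → s i * s j = s j * s i) :
    ∃ φ : Perm (Fin (n + 1)) →* E, ∀ i : Fin n, φ (swap i.castSucc i.succ) = s i := by
  induction n generalizing s with
  | zero => exact ⟨1, fun i => i.elim0⟩
  | succ n ih =>
    obtain ⟨φ', hφ'⟩ := ih (fun i => s (i + 1)) (fun i hi => sq _ (by omega))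
      (fun i hi => braid _ (by omega)) (fun i j hi hj => comm _ _ (by omega) (by omega))
    choose red hred using exists_reduced (n := n)
    let φ : Perm (Fin (n + 2)) → E := fun σ => cyc s (σ 0) * φ' (red σ)
    have hφ : ∀ σ τ, (∀ j, σ j.succ = (σ 0).succAbove (τ j)) → φ σ = cyc s (σ 0) * φ' τ := by
      intro σ τ h
      rw [reduced_unique h (hred σ)]
    have h1 : φ 1 = 1 := by
      rw [hφ 1 1 (by simp)]; simp [cyc]
    -- commutation of the cycles with the generators
    have clt : ∀ p i, p < i → i < n + 1 → s i * cyc s p = cyc s p * s i := by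
      intro p
      induction p with
      | zero => simp [cyc]
      | succ p ihp =>
        intro i hi hin
        rw [cyc, ← mul_assoc, ← comm p i (by omega) hin, mul_assoc, ihp i (by omega) hin, mul_assoc]
    have cgt : ∀ i p, i + 1 < p → p < n + 2 → s i * cyc s p = cyc s p * s (i + 1) := by
      intro i p hp hpn
      induction p, hp using Nat.le_induction with
      | base =>
        rw [cyc, cyc, mul_assoc, mul_assoc, ← clt i (i + 1) (by omega) (by omega)]
        simp only [← mul_assoc]
        rw [braid i (by omega)]
      | succ p hp ihp =>
        rw [cyc, ← mul_assoc, comm i p (by omega) (by omega), mul_assoc, ihp (by omega), mul_assoc]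
    have key : ∀ (i : Fin (n + 1)) σ, φ (swap i.castSucc i.succ * σ) = s i * φ σ := by
      intro i σ
      rw [hφ σ (red σ) (hred σ)]
      rcases lt_trichotomy ((σ 0 : Fin (n+2)) : ℕ) i with h | h | h
      · obtain ⟨k, rfl⟩ : ∃ k : Fin n, i = k.succ :=
          ⟨⟨i - 1, by omega⟩, by ext; simp; omega⟩
        rw [hφ _ (swap k.castSucc k.succ * red σ) (fun j => by
          simpa [hred σ j] using succAbove_swap_lt k (σ 0) (by simpa using h) (red σ j))]
        have e : swap k.succ.castSucc k.succ.succ (σ 0) = σ 0 :=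
          swap_apply_of_ne_of_ne (by simp [Fin.ext_iff] at h ⊢; omega)
            (by simp [Fin.ext_iff] at h ⊢; omega)
        rw [Perm.mul_apply, e, map_mul, hφ', ← mul_assoc, ← mul_assoc, clt _ _ h (by omega)]
        simp
      · have hp : σ 0 = i.castSucc := by ext; simpa using h
        rw [hφ _ (red σ) (fun j => by
          simpa [hred σ j] using succAbove_swap_same i (σ 0) (Or.inl hp) (red σ j))]
        rw [Perm.mul_apply, hp, swap_apply_left]
        simp [cyc, mul_assoc]
      · rcases eq_or_lt_of_le (Nat.succ_le_of_lt h) with h | h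
        · have hp : σ 0 = i.succ := by ext; simpa using h.symm
          rw [hφ _ (red σ) (fun j => by
            simpa [hred σ j] using succAbove_swap_same i (σ 0) (Or.inr hp) (red σ j))]
          rw [Perm.mul_apply, hp, swap_apply_right]
          simp only [Fin.val_succ, cyc, Fin.val_castSucc, ← mul_assoc]
          rw [sq i i.2, one_mul]
        · have := (σ 0).2
          obtain ⟨k, rfl⟩ : ∃ k : Fin n, i = k.castSucc :=
            ⟨⟨i, by omega⟩, by ext; simp⟩
          rw [hφ _ (swap k.castSucc k.succ * red σ) (fun j => by
            simpa [hred σ j] using succAbove_swap_gt k (σ 0) (by simpa using h) (red σ j))]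
          have e : swap k.castSucc.castSucc k.castSucc.succ (σ 0) = σ 0 :=
            swap_apply_of_ne_of_ne (by simp [Fin.ext_iff] at h ⊢; omega)
              (by simp [Fin.ext_iff] at h ⊢; omega)
          rw [Perm.mul_apply, e, map_mul, hφ', ← mul_assoc, ← mul_assoc, cgt _ _ h (by omega)]
          simp
    have gen : ∀ i : Fin (n + 1), φ (swap i.castSucc i.succ) = s i := by
      intro i; simpa [h1] using key i 1
    have mul : ∀ τ σ, φ (τ * σ) = φ τ * φ σ := by
      intro τ
      have hτ : τ ∈ Submonoid.closure
          (Set.range fun i : Fin (n + 1) ↦ swap i.castSucc i.succ) := by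
        rw [Perm.mclosure_swap_castSucc_succ]; trivial
      induction hτ using Submonoid.closure_induction_left with
      | one => simp [h1]
      | mul_left x hx y hy ih =>
        obtain ⟨i, rfl⟩ := hx
        intro σ
        simp only [mul_assoc, key, ih]
    exact ⟨{ toFun := φ, map_one' := h1, map_mul' := mul }, gen⟩

end Perm

section TensorPower
variable {C : Type u} [Category.{v} C] [MonoidalCategory C] [SymmetricCategory C]

/-- The tensor power `M^{⊗ n} = M ⊗ (M ⊗ (⋯ ⊗ 𝟙))`. -/
def tensorPow (M : C) : ℕ → C
  | 0 => 𝟙_ C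
  | n + 1 => M ⊗ tensorPow M n

/-- The symmetry exchanging the factors `i` and `i + 1` of `M^{⊗ n}`
(the identity if `n ≤ i + 1`). -/
def adjSwap (M : C) : (i n : ℕ) → (tensorPow M n ⟶ tensorPow M n)
  | 0, 0 => 𝟙 _
  | 0, 1 => 𝟙 _
  | 0, n + 2 => (α_ M M (tensorPow M n)).inv ≫ (β_ M M).hom ▷ tensorPow M n ≫
      (α_ M M (tensorPow M n)).hom
  | _ + 1, 0 => 𝟙 _
  | i + 1, n + 1 => M ◁ adjSwap M i n

theorem sq_aux (M T : C) :
    ((α_ M M T).inv ≫ (β_ M M).hom ▷ T ≫ (α_ M M T).hom) ≫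
      (α_ M M T).inv ≫ (β_ M M).hom ▷ T ≫ (α_ M M T).hom = 𝟙 _ := by
  simp only [Category.assoc, Iso.hom_inv_id_assoc]
  rw [← comp_whiskerRight_assoc]
  simp

theorem adjSwap_sq (M : C) (i n : ℕ) : adjSwap M i n ≫ adjSwap M i n = 𝟙 _ := by
  induction i generalizing n with
  | zero =>
    match n with
    | 0 => simp [adjSwap]
    | 1 => simp [adjSwap]
    | n + 2 =>
      exact sq_aux M (tensorPow M n)
  | succ i ih =>
    match n with
    | 0 => simp [adjSwap]
    | n + 1 =>
      have := congrArg (fun f => M ◁ f) (ih n)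
      simp only [MonoidalCategory.whiskerLeft_comp, MonoidalCategory.whiskerLeft_id] at this
      exact this

theorem braid_aux (M T : C) :
    let a := (α_ M M (M ⊗ T)).inv ≫ (β_ M M).hom ▷ (M ⊗ T) ≫ (α_ M M (M ⊗ T)).hom
    let b := M ◁ ((α_ M M T).inv ≫ (β_ M M).hom ▷ T ≫ (α_ M M T).hom)
    a ≫ b ≫ a = b ≫ a ≫ b := by
  intro a b
  let Φ : (M ⊗ (M ⊗ M)) ⊗ T ≅ M ⊗ (M ⊗ (M ⊗ T)) :=
    (α_ _ _ _) ≪≫ whiskerLeftIso M (α_ _ _ _)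
  have e0 : a = Φ.inv ≫
      ((α_ M M M).inv ≫ (β_ M M).hom ▷ M ≫ (α_ M M M).hom) ▷ T ≫ Φ.hom := by
    simp [a, Φ]
  have e1 : b = Φ.inv ≫ (M ◁ (β_ M M).hom) ▷ T ≫ Φ.hom := by
    simp [b, Φ]
  rw [e0, e1]
  simp only [Category.assoc, Iso.hom_inv_id_assoc, ← comp_whiskerRight_assoc]
  rw [← BraidedCategory.yang_baxter M M M]

theorem adjSwap_braid (M : C) (i n : ℕ) (h : i + 2 < n) :
    adjSwap M i n ≫ adjSwap M (i + 1) n ≫ adjSwap M i n =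
      adjSwap M (i + 1) n ≫ adjSwap M i n ≫ adjSwap M (i + 1) n := by
  induction i generalizing n with
  | zero =>
    obtain ⟨n, rfl⟩ : ∃ m, n = m + 3 := ⟨n - 3, by omega⟩
    exact braid_aux M (tensorPow M n)
  | succ i ih =>
    obtain ⟨n, rfl⟩ : ∃ m, n = m + 1 := ⟨n - 1, by omega⟩
    have := congrArg (fun f => M ◁ f) (ih n (by omega))
    simp only [MonoidalCategory.whiskerLeft_comp] at this
    exact this

theorem comm_aux (M T : C) (f : T ⟶ T) :
    ((α_ M M T).inv ≫ (β_ M M).hom ▷ T ≫ (α_ M M T).hom) ≫ M ◁ M ◁ f =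
      M ◁ M ◁ f ≫ (α_ M M T).inv ≫ (β_ M M).hom ▷ T ≫ (α_ M M T).hom := by
  have h1 : M ◁ M ◁ f ≫ (α_ M M T).inv = (α_ M M T).inv ≫ (M ⊗ M) ◁ f := by simp
  rw [reassoc_of% h1, whisker_exchange_assoc]
  simp

theorem adjSwap_comm (M : C) (i j n : ℕ) (h : i + 1 < j) :
    adjSwap M i n ≫ adjSwap M j n = adjSwap M j n ≫ adjSwap M i n := by
  induction i generalizing n j with
  | zero =>
    obtain ⟨j, rfl⟩ : ∃ m, j = m + 2 := ⟨j - 2, by omega⟩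
    match n with
    | 0 => simp [adjSwap]
    | 1 =>
      have h1 := Category.id_comp (adjSwap M (j + 2) 1)
      have h2 := Category.comp_id (adjSwap M (j + 2) 1)
      exact h1.trans h2.symm
    | n + 2 => exact comm_aux M (tensorPow M n) (adjSwap M j n)
  | succ i ih =>
    obtain ⟨j, rfl⟩ : ∃ m, j = m + 1 := ⟨j - 1, by omega⟩
    match n with
    | 0 => simp [adjSwap]
    | n + 1 =>
      have := congrArg (fun f => M ◁ f) (ih j n (by omega))
      simp only [MonoidalCategory.whiskerLeft_comp] at this
      exact this

theorem exists_permAction (M : C) (n : ℕ) :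
    ∃ φ : Equiv.Perm (Fin (n + 1)) →* End (tensorPow M (n + 1)),
      ∀ i : Fin n, φ (Equiv.swap i.castSucc i.succ) = adjSwap M i (n + 1) :=
  exists_perm_hom n (E := End (tensorPow M (n + 1))) (fun i => adjSwap M i (n + 1))
    (fun i _ => adjSwap_sq M i _)
    (fun i hi => by simpa [End.mul_def] using adjSwap_braid M i (n + 1) (by omega))
    (fun i j hi _ => by simpa [End.mul_def] using (adjSwap_comm M i j (n + 1) hi).symm)

/-- The action of the symmetric group `𝔖_n` on `M^{⊗ n}` by the symmetry: the homomorphism sending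
each transposition `(i i+1)` to the switch of the factors `i` and `i + 1` (see `permAction_swap`). -/
def permAction (M : C) : (n : ℕ) → Equiv.Perm (Fin n) →* End (tensorPow M n)
  | 0 => 1
  | n + 1 => (exists_permAction M n).choose

theorem permAction_swap (M : C) (n : ℕ) (i : Fin n) :
    permAction M (n + 1) (Equiv.swap i.castSucc i.succ) = adjSwap M i (n + 1) :=
  (exists_permAction M n).choose_spec i

end TensorPower

section ScalarExtension
open TensorProduct

/-- The extension of scalars `C ⊗_K L`: it has the objects of `C`, and morphisms
`L ⊗_K Hom(X, Y)`. -/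
@[nolint unusedArguments]
structure ScalarExt (K : Type w) (L : Type w') (C : Type u) where
  /-- the underlying object -/
  as : C

namespace ScalarExt
variable {K : Type w} [Field K] {L : Type w'} [Field L] [Algebra K L]
  {C : Type u} [Category.{v} C] [Preadditive C] [Linear K C]

variable (K L) in
/-- Composition, extended `L`-bilinearly. -/
def compLin (X Y Z : C) :
    L ⊗[K] (X ⟶ Y) →ₗ[K] L ⊗[K] (Y ⟶ Z) →ₗ[K] L ⊗[K] (X ⟶ Z) :=
  TensorProduct.map₂ (LinearMap.mul K L) (Linear.comp (S := K) X Y Z)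

@[simp]
theorem compLin_tmul {X Y Z : C} (a b : L) (f : X ⟶ Y) (g : Y ⟶ Z) :
    compLin K L X Y Z (a ⊗ₜ f) (b ⊗ₜ g) = (a * b) ⊗ₜ (f ≫ g) := by
  simp [compLin]

instance : Category (ScalarExt K L C) where
  Hom X Y := L ⊗[K] (X.as ⟶ Y.as)
  id X := 1 ⊗ₜ 𝟙 X.as
  comp {X Y Z} f g := compLin K L X.as Y.as Z.as f g
  id_comp f := by
    induction f using TensorProduct.induction_on with
    | zero => simp
    | tmul a f => simp
    | add f g hf hg => simp only [map_add, LinearMap.add_apply, hf, hg]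
  comp_id f := by
    induction f using TensorProduct.induction_on with
    | zero => simp
    | tmul a f => simp
    | add f g hf hg => simp only [map_add, LinearMap.add_apply, hf, hg]
  assoc f g h := by
    induction f using TensorProduct.induction_on with
    | zero => simp
    | add f f' hf hf' => simp only [map_add, LinearMap.add_apply, hf, hf']
    | tmul a f =>
      induction g using TensorProduct.induction_on with
      | zero => simp
      | add g g' hg hg' => simp only [map_add, LinearMap.add_apply, hg, hg']
      | tmul b g =>
        induction h using TensorProduct.induction_on with
        | zero => simp
        | add h h' hh hh' => simp only [map_add, LinearMap.add_apply, hh, hh']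
        | tmul c h => simp [mul_assoc]

/-- The morphism `l ⊗ f`. -/
def homMk {X Y : ScalarExt K L C} (l : L) (f : X.as ⟶ Y.as) : X ⟶ Y := l ⊗ₜ[K] f

instance : Preadditive (ScalarExt K L C) where
  homGroup X Y := inferInstanceAs (AddCommGroup (L ⊗[K] (X.as ⟶ Y.as)))
  add_comp X Y Z f f' g := by
    exact LinearMap.map_add₂ (compLin K L X.as Y.as Z.as) f f' g
  comp_add X Y Z f g g' := by
    exact LinearMap.map_add (compLin K L X.as Y.as Z.as f) g g'

@[elab_as_elim]
theorem hom_induction {X Y : ScalarExt K L C} {P : (X ⟶ Y) → Prop}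
    (mk : ∀ (l : L) (f : X.as ⟶ Y.as), P (homMk l f))
    (add : ∀ f g : X ⟶ Y, P f → P g → P (f + g)) (f : X ⟶ Y) : P f := by
  refine TensorProduct.induction_on (motive := P) f ?_ mk add
  have := mk 0 0
  rwa [homMk, TensorProduct.zero_tmul] at this

@[simp]
theorem homMk_comp {X Y Z : ScalarExt K L C} (a b : L) (f : X.as ⟶ Y.as) (g : Y.as ⟶ Z.as) :
    (homMk a f : X ⟶ Y) ≫ (homMk b g : Y ⟶ Z) = homMk (a * b) (f ≫ g) :=
  compLin_tmul a b f g

theorem id_eq (X : ScalarExt K L C) : 𝟙 X = homMk 1 (𝟙 X.as) := rfl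

instance (X Y : ScalarExt K L C) : Module L (X ⟶ Y) :=
  inferInstanceAs (Module L (L ⊗[K] (X.as ⟶ Y.as)))

@[simp]
theorem smul_homMk {X Y : ScalarExt K L C} (r a : L) (f : X.as ⟶ Y.as) :
    r • (homMk a f : X ⟶ Y) = homMk (r * a) f := rfl

instance : Linear L (ScalarExt K L C) where
  smul_comp X Y Z r f g := by
    induction f using hom_induction with
    | add f f' hf hf' => simp only [smul_add, Preadditive.add_comp, hf, hf']
    | mk a f =>
      induction g using hom_induction with
      | add g g' hg hg' => simp only [smul_add, Preadditive.comp_add, hg, hg']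
      | mk b g => simp [mul_assoc]
  comp_smul X Y Z f r g := by
    induction f using hom_induction with
    | add f f' hf hf' => simp only [smul_add, Preadditive.add_comp, hf, hf']
    | mk a f =>
      induction g using hom_induction with
      | add g g' hg hg' => simp only [smul_add, Preadditive.comp_add, hg, hg']
      | mk b g => simp [mul_left_comm]

variable (K L C) in
/-- The extension of scalars functor `C ⥤ C ⊗_K L`. -/
def extend : C ⥤ ScalarExt K L C where
  obj X := ⟨X⟩
  map f := homMk 1 f
  map_id X := rfl
  map_comp f g := by simp

section Monoidal
variable [MonoidalCategory C] [MonoidalPreadditive C] [MonoidalLinear K C]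

/-- The morphism `1 ⊗ f` of `C ⊗_K L`. -/
def wL (W : C) {X Y : ScalarExt K L C} (f : X ⟶ Y) :
    (⟨W ⊗ X.as⟩ : ScalarExt K L C) ⟶ ⟨W ⊗ Y.as⟩ :=
  LinearMap.lTensor L ((tensorLeft W).mapLinearMap K (X := X.as) (Y := Y.as)) f

/-- The morphism `f ⊗ 1` of `C ⊗_K L`. -/
def wR {X Y : ScalarExt K L C} (f : X ⟶ Y) (W : C) :
    (⟨X.as ⊗ W⟩ : ScalarExt K L C) ⟶ ⟨Y.as ⊗ W⟩ :=
  LinearMap.lTensor L ((tensorRight W).mapLinearMap K (X := X.as) (Y := Y.as)) f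

instance : MonoidalCategoryStruct (ScalarExt K L C) where
  tensorObj X Y := ⟨X.as ⊗ Y.as⟩
  tensorUnit := ⟨𝟙_ C⟩
  whiskerLeft X _ _ f := wL X.as f
  whiskerRight f X := wR f X.as
  tensorHom {_ Y₁ X₂ _} f g := wR f X₂.as ≫ wL Y₁.as g
  associator X Y Z := (extend K L C).mapIso (α_ X.as Y.as Z.as)
  leftUnitor X := (extend K L C).mapIso (λ_ X.as)
  rightUnitor X := (extend K L C).mapIso (ρ_ X.as)

@[simp]
theorem whiskerLeft_homMk (W : ScalarExt K L C) {X Y : ScalarExt K L C} (a : L)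
    (f : X.as ⟶ Y.as) :
    W ◁ (homMk a f : X ⟶ Y) = homMk a (W.as ◁ f) := rfl

@[simp]
theorem homMk_whiskerRight {X Y : ScalarExt K L C} (a : L)
    (f : X.as ⟶ Y.as) (W : ScalarExt K L C) :
    (homMk a f : X ⟶ Y) ▷ W = homMk a (f ▷ W.as) := rfl

@[simp]
theorem whiskerLeft_add' (W : ScalarExt K L C) {X Y : ScalarExt K L C} (f g : X ⟶ Y) :
    W ◁ (f + g) = W ◁ f + W ◁ g :=
  map_add (LinearMap.lTensor L ((tensorLeft W.as).mapLinearMap K)) f g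

@[simp]
theorem add_whiskerRight' {X Y : ScalarExt K L C} (f g : X ⟶ Y) (W : ScalarExt K L C) :
    (f + g) ▷ W = f ▷ W + g ▷ W :=
  map_add (LinearMap.lTensor L ((tensorRight W.as).mapLinearMap K)) f g

@[simp]
theorem homMk_tensorHom {X Y X' Y' : ScalarExt K L C} (a b : L)
    (f : X.as ⟶ Y.as) (g : X'.as ⟶ Y'.as) :
    (homMk a f : X ⟶ Y) ⊗ₘ (homMk b g : X' ⟶ Y') = homMk (a * b) (f ⊗ₘ g) := by
  rw [MonoidalCategory.tensorHom_def]
  exact homMk_comp (X := ⟨_⟩) (Y := ⟨_⟩) (Z := ⟨_⟩) a b _ _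

theorem tensorHom_def'' {X Y X' Y' : ScalarExt K L C} (f : X ⟶ Y) (g : X' ⟶ Y') :
  f ⊗ₘ g = f ▷ X' ≫ Y ◁ g := rfl

@[simp]
theorem tensorHom_add' {X Y X' Y' : ScalarExt K L C} (f : X ⟶ Y) (g g' : X' ⟶ Y') :
  f ⊗ₘ (g + g') = f ⊗ₘ g + f ⊗ₘ g' := by simp [tensorHom_def'']

@[simp]
theorem add_tensorHom' {X Y X' Y' : ScalarExt K L C} (f f' : X ⟶ Y) (g : X' ⟶ Y') :
  (f + f') ⊗ₘ g = f ⊗ₘ g + f' ⊗ₘ g := by simp [tensorHom_def'']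

@[simp] theorem tensorObj_as (X Y : ScalarExt K L C) : (X ⊗ Y).as = X.as ⊗ Y.as := rfl
@[simp] theorem tensorUnit_as : (𝟙_ (ScalarExt K L C)).as = 𝟙_ C := rfl
theorem associator_hom_eq (X Y Z : ScalarExt K L C) :
  (α_ X Y Z).hom = homMk 1 (α_ X.as Y.as Z.as).hom := rfl
theorem associator_inv_eq (X Y Z : ScalarExt K L C) :
  (α_ X Y Z).inv = homMk 1 (α_ X.as Y.as Z.as).inv := rfl
theorem leftUnitor_hom_eq (X : ScalarExt K L C) : (λ_ X).hom = homMk 1 (λ_ X.as).hom := rfl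
theorem leftUnitor_inv_eq (X : ScalarExt K L C) : (λ_ X).inv = homMk 1 (λ_ X.as).inv := rfl
theorem rightUnitor_hom_eq (X : ScalarExt K L C) : (ρ_ X).hom = homMk 1 (ρ_ X.as).hom := rfl
theorem rightUnitor_inv_eq (X : ScalarExt K L C) : (ρ_ X).inv = homMk 1 (ρ_ X.as).inv := rfl

instance : MonoidalCategory (ScalarExt K L C) where
  tensorHom_def _ _ := rfl
  id_tensorHom_id X Y := by
    simp only [id_eq, homMk_tensorHom]; simp
  tensorHom_comp_tensorHom f g h k := by
    induction f using hom_induction with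
    | add f f' hf hf' => simp only [tensorHom_add', add_tensorHom', whiskerLeft_add', add_whiskerRight',
        Preadditive.add_comp, Preadditive.comp_add, hf, hf']
    | mk a f =>
    induction g using hom_induction with
    | add f f' hf hf' => simp only [tensorHom_add', add_tensorHom', whiskerLeft_add', add_whiskerRight',
        Preadditive.add_comp, Preadditive.comp_add, hf, hf']
    | mk b g =>
    induction h using hom_induction with
    | add f f' hf hf' => simp only [tensorHom_add', add_tensorHom', whiskerLeft_add', add_whiskerRight',
        Preadditive.add_comp, Preadditive.comp_add, hf, hf']
    | mk c h =>
    induction k using hom_induction with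
    | add f f' hf hf' => simp only [tensorHom_add', add_tensorHom', whiskerLeft_add', add_whiskerRight',
        Preadditive.add_comp, Preadditive.comp_add, hf, hf']
    | mk d k =>
      simp only [homMk_tensorHom, homMk_comp]
      rw [MonoidalCategory.tensorHom_comp_tensorHom, mul_mul_mul_comm]
  whiskerLeft_id X Y := by simp [id_eq]
  id_whiskerRight X Y := by simp [id_eq]
  associator_naturality f g h := by
    induction f using hom_induction with
    | add f f' hf hf' => simp only [tensorHom_add', add_tensorHom', whiskerLeft_add', add_whiskerRight',
        Preadditive.add_comp, Preadditive.comp_add, hf, hf']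
    | mk a f =>
    induction g using hom_induction with
    | add f f' hf hf' => simp only [tensorHom_add', add_tensorHom', whiskerLeft_add', add_whiskerRight',
        Preadditive.add_comp, Preadditive.comp_add, hf, hf']
    | mk b g =>
    induction h using hom_induction with
    | add f f' hf hf' => simp only [tensorHom_add', add_tensorHom', whiskerLeft_add', add_whiskerRight',
        Preadditive.add_comp, Preadditive.comp_add, hf, hf']
    | mk c h =>
      simp only [homMk_tensorHom, associator_hom_eq]
      erw [homMk_comp, homMk_comp]
      rw [MonoidalCategory.associator_naturality, mul_one, one_mul, mul_assoc]
  leftUnitor_naturality f := by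
    induction f using hom_induction with
    | add f f' hf hf' => simp only [tensorHom_add', add_tensorHom', whiskerLeft_add', add_whiskerRight',
        Preadditive.add_comp, Preadditive.comp_add, hf, hf']
    | mk a f =>
      simp only [leftUnitor_hom_eq, whiskerLeft_homMk]
      erw [homMk_comp, homMk_comp]
      erw [MonoidalCategory.leftUnitor_naturality]
      rw [mul_one, one_mul]
  rightUnitor_naturality f := by
    induction f using hom_induction with
    | add f f' hf hf' => simp only [tensorHom_add', add_tensorHom', whiskerLeft_add', add_whiskerRight',
        Preadditive.add_comp, Preadditive.comp_add, hf, hf']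
    | mk a f =>
      simp only [rightUnitor_hom_eq, homMk_whiskerRight]
      erw [homMk_comp, homMk_comp]
      erw [MonoidalCategory.rightUnitor_naturality]
      rw [mul_one, one_mul]
  pentagon W X Y Z := by
    have := congrArg (extend K L C).map (MonoidalCategory.pentagon W.as X.as Y.as Z.as)
    simp only [Functor.map_comp] at this
    exact this
  triangle X Y := by
    have := congrArg (extend K L C).map (MonoidalCategory.triangle X.as Y.as)
    simp only [Functor.map_comp] at this
    exact this

instance : MonoidalPreadditive (ScalarExt K L C) where
  whiskerLeft_zero {W X Y} :=
    map_zero (LinearMap.lTensor L ((tensorLeft W.as).mapLinearMap K (X := X.as) (Y := Y.as)))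
  zero_whiskerRight {W X Y} :=
    map_zero (LinearMap.lTensor L ((tensorRight W.as).mapLinearMap K (X := X.as) (Y := Y.as)))

instance : MonoidalLinear L (ScalarExt K L C) where
  whiskerLeft_smul W X Y r f := by
    induction f using hom_induction with
    | add f f' hf hf' => simp [hf, hf']
    | mk a f => simp
  smul_whiskerRight r X Y f W := by
    induction f using hom_induction with
    | add f f' hf hf' => simp [hf, hf']
    | mk a f => simp

instance [SymmetricCategory C] : SymmetricCategory (ScalarExt K L C) where
  braiding X Y := (extend K L C).mapIso (β_ X.as Y.as)
  braiding_naturality_right X Y Z f := by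
    induction f using hom_induction with
    | add f f' hf hf' => simp only [whiskerLeft_add', add_whiskerRight',
        Preadditive.add_comp, Preadditive.comp_add, hf, hf']
    | mk a f =>
      dsimp [extend]
      simp
  braiding_naturality_left f X := by
    induction f using hom_induction with
    | add f f' hf hf' => simp only [whiskerLeft_add', add_whiskerRight',
        Preadditive.add_comp, Preadditive.comp_add, hf, hf']
    | mk a f =>
      dsimp [extend]
      simp
  hexagon_forward X Y Z := by
    have := congrArg (extend K L C).map (BraidedCategory.hexagon_forward X.as Y.as Z.as)
    simp only [Functor.map_comp] at this
    exact this
  hexagon_reverse X Y Z := by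
    have := congrArg (extend K L C).map (BraidedCategory.hexagon_reverse X.as Y.as Z.as)
    simp only [Functor.map_comp] at this
    exact this
  symmetry X Y := by
    have := congrArg (extend K L C).map (SymmetricCategory.symmetry X.as Y.as)
    simp only [Functor.map_comp] at this
    exact this

instance [LeftRigidCategory C] : LeftRigidCategory (ScalarExt K L C) where
  leftDual X :=
    { leftDual := ⟨ᘁX.as⟩
      exact :=
        { coevaluation' := homMk 1 (η_ (ᘁX.as) X.as)
          evaluation' := homMk 1 (ε_ (ᘁX.as) X.as)
          coevaluation_evaluation' := by
            have := congrArg (extend K L C).map (ExactPairing.coevaluation_evaluation (ᘁX.as) X.as)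
            simp only [Functor.map_comp] at this
            exact this
          evaluation_coevaluation' := by
            have := congrArg (extend K L C).map (ExactPairing.evaluation_coevaluation (ᘁX.as) X.as)
            simp only [Functor.map_comp] at this
            exact this } }

end Monoidal
end ScalarExt
end ScalarExtension

/-- A finite-dimensional `ℤ/2`-graded vector space over `L`. -/
structure SuperVect (L : Type w) [Field L] where
  /-- degree `0` part -/
  even : Type w
  /-- degree `1` part -/
  odd : Type w
  [evenAddCommGroup : AddCommGroup even]
  [evenModule : Module L even]
  [evenFinite : FiniteDimensional L even]
  [oddAddCommGroup : AddCommGroup odd]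
  [oddModule : Module L odd]
  [oddFinite : FiniteDimensional L odd]

namespace SuperVect
open TensorProduct

attribute [instance] evenAddCommGroup evenModule evenFinite oddAddCommGroup oddModule oddFinite

variable {L : Type w} [Field L]

/-- Morphisms: linear maps of degree `0`. -/
@[ext]
structure Hom (V W : SuperVect L) where
  /-- even part -/
  even : V.even →ₗ[L] W.even
  /-- odd part -/
  odd : V.odd →ₗ[L] W.odd

instance : Category (SuperVect L) where
  Hom V W := Hom V W
  id V := ⟨LinearMap.id, LinearMap.id⟩
  comp f g := ⟨g.even ∘ₗ f.even, g.odd ∘ₗ f.odd⟩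

@[simp] theorem id_even (V : SuperVect L) : Hom.even (𝟙 V) = LinearMap.id := rfl
@[simp] theorem id_odd (V : SuperVect L) : Hom.odd (𝟙 V) = LinearMap.id := rfl
@[simp] theorem comp_even {U V W : SuperVect L} (f : U ⟶ V) (g : V ⟶ W) :
    (f ≫ g).even = g.even ∘ₗ f.even := rfl
@[simp] theorem comp_odd {U V W : SuperVect L} (f : U ⟶ V) (g : V ⟶ W) :
    (f ≫ g).odd = g.odd ∘ₗ f.odd := rfl

@[ext]
theorem hom_ext {V W : SuperVect L} {f g : V ⟶ W} (h₀ : f.even = g.even) (h₁ : f.odd = g.odd) :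
    f = g := Hom.ext h₀ h₁

section Linear
variable {V W : SuperVect L}
instance : Add (V ⟶ W) := ⟨fun f g => ⟨f.even + g.even, f.odd + g.odd⟩⟩
instance : Zero (V ⟶ W) := ⟨⟨0, 0⟩⟩
instance : Neg (V ⟶ W) := ⟨fun f => ⟨-f.even, -f.odd⟩⟩
instance : SMul L (V ⟶ W) := ⟨fun r f => ⟨r • f.even, r • f.odd⟩⟩
@[simp] theorem add_even (f g : V ⟶ W) : (f + g).even = f.even + g.even := rfl
@[simp] theorem add_odd (f g : V ⟶ W) : (f + g).odd = f.odd + g.odd := rfl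
@[simp] theorem zero_even : (0 : V ⟶ W).even = 0 := rfl
@[simp] theorem zero_odd : (0 : V ⟶ W).odd = 0 := rfl
@[simp] theorem neg_even (f : V ⟶ W) : (-f).even = -f.even := rfl
@[simp] theorem neg_odd (f : V ⟶ W) : (-f).odd = -f.odd := rfl
@[simp] theorem smul_even (r : L) (f : V ⟶ W) : (r • f).even = r • f.even := rfl
@[simp] theorem smul_odd (r : L) (f : V ⟶ W) : (r • f).odd = r • f.odd := rfl

instance : AddCommGroup (V ⟶ W) where
  add_assoc _ _ _ := hom_ext (add_assoc _ _ _) (add_assoc _ _ _)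
  zero_add _ := hom_ext (zero_add _) (zero_add _)
  add_zero _ := hom_ext (add_zero _) (add_zero _)
  add_comm _ _ := hom_ext (add_comm _ _) (add_comm _ _)
  neg_add_cancel _ := hom_ext (neg_add_cancel _) (neg_add_cancel _)
  nsmul := nsmulRec
  zsmul := zsmulRec

instance : Module L (V ⟶ W) where
  one_smul _ := hom_ext (one_smul _ _) (one_smul _ _)
  mul_smul _ _ _ := hom_ext (mul_smul _ _ _) (mul_smul _ _ _)
  smul_zero _ := hom_ext (smul_zero _) (smul_zero _)
  smul_add _ _ _ := hom_ext (smul_add _ _ _) (smul_add _ _ _)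
  add_smul _ _ _ := hom_ext (add_smul _ _ _) (add_smul _ _ _)
  zero_smul _ := hom_ext (zero_smul _ _) (zero_smul _ _)
end Linear

instance : Preadditive (SuperVect L) where
  add_comp _ _ _ f f' g := by ext <;> simp
  comp_add _ _ _ f g g' := by ext <;> simp

instance : Linear L (SuperVect L) where
  smul_comp _ _ _ r f g := by ext <;> simp
  comp_smul _ _ _ f r g := by ext <;> simp

/-- An isomorphism from linear equivalences in each degree. -/
@[simps]
def isoMk {V W : SuperVect L} (e₀ : V.even ≃ₗ[L] W.even) (e₁ : V.odd ≃ₗ[L] W.odd) : V ≅ W where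
  hom := ⟨e₀, e₁⟩
  inv := ⟨e₀.symm, e₁.symm⟩

section Aux
variable (R : Type w) [CommRing R] (X₀ X₁ Y₀ Y₁ U U' : Type w) [AddCommGroup X₀] [AddCommGroup X₁]
  [AddCommGroup Y₀] [AddCommGroup Y₁] [AddCommGroup U] [AddCommGroup U'] [Module R X₀]
  [Module R X₁] [Module R Y₀] [Module R Y₁] [Module R U] [Module R U']

/-- The associativity of the graded tensor product in one degree: it rearranges
`(x ⊗ y) ⊗ u` as `x ⊗ (y ⊗ u)`. -/
def assocAux :
    ((((X₀ ⊗[R] Y₀) × (X₁ ⊗[R] Y₁)) ⊗[R] U) × (((X₀ ⊗[R] Y₁) × (X₁ ⊗[R] Y₀)) ⊗[R] U')) ≃ₗ[R]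
      ((X₀ ⊗[R] ((Y₀ ⊗[R] U) × (Y₁ ⊗[R] U'))) × (X₁ ⊗[R] ((Y₀ ⊗[R] U') × (Y₁ ⊗[R] U)))) :=
  (TensorProduct.prodLeft R R _ _ _).prodCongr (TensorProduct.prodLeft R R _ _ _) ≪≫ₗ
    LinearEquiv.prodProdProdComm R _ _ _ _ ≪≫ₗ
    ((TensorProduct.assoc R _ _ _).prodCongr (TensorProduct.assoc R _ _ _)).prodCongr
      (LinearEquiv.prodComm R _ _ ≪≫ₗ
        (TensorProduct.assoc R _ _ _).prodCongr (TensorProduct.assoc R _ _ _)) ≪≫ₗ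
    (TensorProduct.prodRight R R _ _ _).symm.prodCongr (TensorProduct.prodRight R R _ _ _).symm

variable {X₀ X₁ Y₀ Y₁ U U'}

@[simp]
theorem prodRight_symm_inl (x : X₀) (y : Y₀) :
    (TensorProduct.prodRight R R X₀ Y₀ Y₁).symm (x ⊗ₜ y, 0) = x ⊗ₜ (y, 0) := by
  simp [LinearEquiv.symm_apply_eq]

@[simp]
theorem prodRight_symm_inr (x : X₀) (y : Y₁) :
    (TensorProduct.prodRight R R X₀ Y₀ Y₁).symm (0, x ⊗ₜ y) = x ⊗ₜ (0, y) := by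
  simp [LinearEquiv.symm_apply_eq]

theorem mk_zero_neg (x : X₀) : ((0 : X₁), -x) = -(0, x) := by simp

theorem mk_neg_zero (x : X₀) : (-x, (0 : X₁)) = -(x, 0) := by simp

@[simp]
theorem prodProdProdComm_apply' {A B D E : Type w} [AddCommGroup A] [AddCommGroup B]
    [AddCommGroup D] [AddCommGroup E] [Module R A] [Module R B] [Module R D] [Module R E]
    (x : (A × B) × D × E) :
    LinearEquiv.prodProdProdComm R A B D E x = ((x.1.1, x.2.1), (x.1.2, x.2.2)) := rfl

@[simp]
theorem assocAux_00 (x : X₀) (y : Y₀) (u : U) :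
    assocAux R X₀ X₁ Y₀ Y₁ U U' ((x ⊗ₜ y, 0) ⊗ₜ u, 0) = (x ⊗ₜ (y ⊗ₜ u, 0), 0) := by
  simp [assocAux]

@[simp]
theorem assocAux_11 (x : X₁) (y : Y₁) (u : U) :
    assocAux R X₀ X₁ Y₀ Y₁ U U' ((0, x ⊗ₜ y) ⊗ₜ u, 0) = (0, x ⊗ₜ (0, y ⊗ₜ u)) := by
  simp [assocAux]

@[simp]
theorem assocAux_01 (x : X₀) (y : Y₁) (u : U') :
    assocAux R X₀ X₁ Y₀ Y₁ U U' (0, (x ⊗ₜ y, 0) ⊗ₜ u) = (x ⊗ₜ (0, y ⊗ₜ u), 0) := by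
  simp [assocAux]

@[simp]
theorem assocAux_10 (x : X₁) (y : Y₀) (u : U') :
    assocAux R X₀ X₁ Y₀ Y₁ U U' (0, (0, x ⊗ₜ y) ⊗ₜ u) = (0, x ⊗ₜ (y ⊗ₜ u, 0)) := by
  simp [assocAux]

variable (X₀ X₁ Y₀ Y₁)

/-- A tensor product with zero can be dropped from a product. -/
def lUnitAux : ((R ⊗[R] X₀) × (PUnit.{w + 1} ⊗[R] X₁)) ≃ₗ[R] X₀ where
  toFun p := TensorProduct.lid R X₀ p.1
  map_add' p q := by simp
  map_smul' r p := by simp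
  invFun x := ((TensorProduct.lid R X₀).symm x, 0)
  left_inv p := Prod.ext (by simp) (Subsingleton.elim _ _)
  right_inv x := by simp

/-- A tensor product with zero can be dropped from a product. -/
def rUnitAux : ((X₀ ⊗[R] R) × (X₁ ⊗[R] PUnit.{w + 1})) ≃ₗ[R] X₀ where
  toFun p := TensorProduct.rid R X₀ p.1
  map_add' p q := by simp
  map_smul' r p := by simp
  invFun x := ((TensorProduct.rid R X₀).symm x, 0)
  left_inv p := Prod.ext (by simp) (Subsingleton.elim _ _)
  right_inv x := by simp

@[simp] theorem lUnitAux_apply (p) : lUnitAux R X₀ X₁ p = TensorProduct.lid R X₀ p.1 := rfl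
@[simp] theorem rUnitAux_apply (p) : rUnitAux R X₀ X₁ p = TensorProduct.rid R X₀ p.1 := rfl


variable {X₀ X₁ Y₀ Y₁}

theorem map_prodMap_comp {A A' A'' B B' B'' : Type w} [AddCommGroup A] [AddCommGroup A']
    [AddCommGroup A''] [AddCommGroup B] [AddCommGroup B'] [AddCommGroup B''] [Module R A]
    [Module R A'] [Module R A''] [Module R B] [Module R B'] [Module R B'']
    (f : A →ₗ[R] A') (f' : A' →ₗ[R] A'') (g : B →ₗ[R] B') (g' : B' →ₗ[R] B'') :
    (f'.prodMap g') ∘ₗ (f.prodMap g) = (f' ∘ₗ f).prodMap (g' ∘ₗ g) := rfl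

theorem assocAux_naturality {X₀' X₁' Y₀' Y₁' V V' : Type w} [AddCommGroup X₀'] [AddCommGroup X₁']
    [AddCommGroup Y₀'] [AddCommGroup Y₁'] [AddCommGroup V] [AddCommGroup V'] [Module R X₀']
    [Module R X₁'] [Module R Y₀'] [Module R Y₁'] [Module R V] [Module R V']
    (f₀ : X₀ →ₗ[R] X₀') (f₁ : X₁ →ₗ[R] X₁') (g₀ : Y₀ →ₗ[R] Y₀') (g₁ : Y₁ →ₗ[R] Y₁')
    (h : U →ₗ[R] V) (h' : U' →ₗ[R] V') :
    (assocAux R X₀' X₁' Y₀' Y₁' V V').toLinearMap ∘ₗ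
      (TensorProduct.map ((TensorProduct.map f₀ g₀).prodMap (TensorProduct.map f₁ g₁)) h).prodMap
        (TensorProduct.map ((TensorProduct.map f₀ g₁).prodMap (TensorProduct.map f₁ g₀)) h') =
    (TensorProduct.map f₀ ((TensorProduct.map g₀ h).prodMap (TensorProduct.map g₁ h'))).prodMap
        (TensorProduct.map f₁ ((TensorProduct.map g₀ h').prodMap (TensorProduct.map g₁ h))) ∘ₗ
      (assocAux R X₀ X₁ Y₀ Y₁ U U').toLinearMap := by
  ext <;> simp

theorem assocAux_pentagon {Z₀ Z₁ : Type w} [AddCommGroup Z₀] [AddCommGroup Z₁] [Module R Z₀]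
    [Module R Z₁] :
    (TensorProduct.map LinearMap.id (assocAux R Y₀ Y₁ Z₀ Z₁ U U').toLinearMap).prodMap
        (TensorProduct.map LinearMap.id (assocAux R Y₀ Y₁ Z₀ Z₁ U' U).toLinearMap) ∘ₗ
      (assocAux R X₀ X₁ ((Y₀ ⊗[R] Z₀) × (Y₁ ⊗[R] Z₁)) ((Y₀ ⊗[R] Z₁) × (Y₁ ⊗[R] Z₀))
        U U').toLinearMap ∘ₗ
      (TensorProduct.map (assocAux R X₀ X₁ Y₀ Y₁ Z₀ Z₁).toLinearMap LinearMap.id).prodMap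
        (TensorProduct.map (assocAux R X₀ X₁ Y₀ Y₁ Z₁ Z₀).toLinearMap LinearMap.id) =
    (assocAux R X₀ X₁ Y₀ Y₁ ((Z₀ ⊗[R] U) × (Z₁ ⊗[R] U')) ((Z₀ ⊗[R] U') × (Z₁ ⊗[R] U))).toLinearMap ∘ₗ
    (assocAux R ((X₀ ⊗[R] Y₀) × (X₁ ⊗[R] Y₁)) ((X₀ ⊗[R] Y₁) × (X₁ ⊗[R] Y₀)) Z₀ Z₁
        U U').toLinearMap := by
  ext <;> simp

theorem unitAux_triangle :
    (TensorProduct.map LinearMap.id (lUnitAux R Y₀ Y₁).toLinearMap).prodMap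
        (TensorProduct.map LinearMap.id (lUnitAux R Y₁ Y₀).toLinearMap) ∘ₗ
      (assocAux R X₀ X₁ R PUnit.{w + 1} Y₀ Y₁).toLinearMap =
    (TensorProduct.map (rUnitAux R X₀ X₁).toLinearMap LinearMap.id).prodMap
      (TensorProduct.map (LinearEquiv.prodComm R _ _ ≪≫ₗ rUnitAux R X₁ X₀).toLinearMap
        LinearMap.id) := by
  ext <;> simp

theorem lUnitAux_naturality (f₀ : X₀ →ₗ[R] Y₀) (f₁ : X₁ →ₗ[R] Y₁) :
    (lUnitAux R Y₀ Y₁).toLinearMap ∘ₗ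
      (TensorProduct.map LinearMap.id f₀).prodMap (TensorProduct.map LinearMap.id f₁) =
    f₀ ∘ₗ (lUnitAux R X₀ X₁).toLinearMap := by
  ext <;> simp

theorem rUnitAux_naturality (f₀ : X₀ →ₗ[R] Y₀) (f₁ : X₁ →ₗ[R] Y₁) :
    (rUnitAux R Y₀ Y₁).toLinearMap ∘ₗ
      (TensorProduct.map f₀ LinearMap.id).prodMap (TensorProduct.map f₁ LinearMap.id) =
    f₀ ∘ₗ (rUnitAux R X₀ X₁).toLinearMap := by
  ext <;> simp

theorem rUnitAux_naturality' (f₀ : X₀ →ₗ[R] Y₀) (f₁ : X₁ →ₗ[R] Y₁) :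
    (LinearEquiv.prodComm R _ _ ≪≫ₗ rUnitAux R Y₁ Y₀).toLinearMap ∘ₗ
      (TensorProduct.map f₀ LinearMap.id).prodMap (TensorProduct.map f₁ LinearMap.id) =
    f₁ ∘ₗ (LinearEquiv.prodComm R _ _ ≪≫ₗ rUnitAux R X₁ X₀).toLinearMap := by
  ext <;> simp

variable (X₀ X₁ Y₀ Y₁)

/-- `(x ⊗ y, x' ⊗ y') ↦ (y ⊗ x, - y' ⊗ x')`. -/
def commEven : ((X₀ ⊗[R] Y₀) × (X₁ ⊗[R] Y₁)) ≃ₗ[R] ((Y₀ ⊗[R] X₀) × (Y₁ ⊗[R] X₁)) :=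
  (TensorProduct.comm R X₀ Y₀).prodCongr (TensorProduct.comm R X₁ Y₁ ≪≫ₗ LinearEquiv.neg R)

/-- `(x ⊗ y, x' ⊗ y') ↦ (y' ⊗ x', y ⊗ x)`. -/
def commOdd : ((X₀ ⊗[R] Y₁) × (X₁ ⊗[R] Y₀)) ≃ₗ[R] ((Y₀ ⊗[R] X₁) × (Y₁ ⊗[R] X₀)) :=
  (TensorProduct.comm R X₀ Y₁).prodCongr (TensorProduct.comm R X₁ Y₀) ≪≫ₗ
    LinearEquiv.prodComm R _ _

variable {X₀ X₁ Y₀ Y₁}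

@[simp] theorem prodComm_apply' {A B : Type w} [AddCommGroup A] [AddCommGroup B] [Module R A]
    [Module R B] (p : A × B) : LinearEquiv.prodComm R A B p = (p.2, p.1) := rfl
@[simp] theorem commEven_inl (x : X₀ ⊗[R] Y₀) :
    commEven R X₀ X₁ Y₀ Y₁ (x, 0) = (TensorProduct.comm R X₀ Y₀ x, 0) := by simp [commEven]
@[simp] theorem commEven_inr (x : X₁ ⊗[R] Y₁) :
    commEven R X₀ X₁ Y₀ Y₁ (0, x) = (0, -TensorProduct.comm R X₁ Y₁ x) := by simp [commEven]
@[simp] theorem commOdd_inl (x : X₀ ⊗[R] Y₁) :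
    commOdd R X₀ X₁ Y₀ Y₁ (x, 0) = (0, TensorProduct.comm R X₀ Y₁ x) := by simp [commOdd]
@[simp] theorem commOdd_inr (x : X₁ ⊗[R] Y₀) :
    commOdd R X₀ X₁ Y₀ Y₁ (0, x) = (TensorProduct.comm R X₁ Y₀ x, 0) := by simp [commOdd]

theorem commEven_naturality {X₀' X₁' Y₀' Y₁' : Type w} [AddCommGroup X₀'] [AddCommGroup X₁']
    [AddCommGroup Y₀'] [AddCommGroup Y₁'] [Module R X₀']
    [Module R X₁'] [Module R Y₀'] [Module R Y₁']
    (f₀ : X₀ →ₗ[R] X₀') (f₁ : X₁ →ₗ[R] X₁') (g₀ : Y₀ →ₗ[R] Y₀') (g₁ : Y₁ →ₗ[R] Y₁') :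
    (commEven R X₀' X₁' Y₀' Y₁').toLinearMap ∘ₗ
      (TensorProduct.map f₀ g₀).prodMap (TensorProduct.map f₁ g₁) =
    (TensorProduct.map g₀ f₀).prodMap (TensorProduct.map g₁ f₁) ∘ₗ
      (commEven R X₀ X₁ Y₀ Y₁).toLinearMap := by
  ext <;> simp

theorem commOdd_naturality {X₀' X₁' Y₀' Y₁' : Type w} [AddCommGroup X₀'] [AddCommGroup X₁']
    [AddCommGroup Y₀'] [AddCommGroup Y₁'] [Module R X₀']
    [Module R X₁'] [Module R Y₀'] [Module R Y₁']
    (f₀ : X₀ →ₗ[R] X₀') (f₁ : X₁ →ₗ[R] X₁') (g₀ : Y₀ →ₗ[R] Y₀') (g₁ : Y₁ →ₗ[R] Y₁') :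
    (commOdd R X₀' X₁' Y₀' Y₁').toLinearMap ∘ₗ
      (TensorProduct.map f₀ g₁).prodMap (TensorProduct.map f₁ g₀) =
    (TensorProduct.map g₀ f₁).prodMap (TensorProduct.map g₁ f₀) ∘ₗ
      (commOdd R X₀ X₁ Y₀ Y₁).toLinearMap := by
  ext <;> simp

theorem commEven_symm :
    (commEven R Y₀ Y₁ X₀ X₁).toLinearMap ∘ₗ (commEven R X₀ X₁ Y₀ Y₁).toLinearMap =
      LinearMap.id := by
  ext <;> simp

theorem commOdd_symm :
    (commOdd R Y₀ Y₁ X₀ X₁).toLinearMap ∘ₗ (commOdd R X₀ X₁ Y₀ Y₁).toLinearMap =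
      LinearMap.id := by
  ext <;> simp

theorem hexagon_even :
    (assocAux R Y₀ Y₁ U U' X₀ X₁).toLinearMap ∘ₗ
      (commEven R X₀ X₁ ((Y₀ ⊗[R] U) × (Y₁ ⊗[R] U'))
        ((Y₀ ⊗[R] U') × (Y₁ ⊗[R] U))).toLinearMap ∘ₗ
      (assocAux R X₀ X₁ Y₀ Y₁ U U').toLinearMap =
    (TensorProduct.map LinearMap.id (commEven R X₀ X₁ U U').toLinearMap).prodMap
        (TensorProduct.map LinearMap.id (commOdd R X₀ X₁ U U').toLinearMap) ∘ₗ
      (assocAux R Y₀ Y₁ X₀ X₁ U U').toLinearMap ∘ₗ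
      (TensorProduct.map (commEven R X₀ X₁ Y₀ Y₁).toLinearMap LinearMap.id).prodMap
        (TensorProduct.map (commOdd R X₀ X₁ Y₀ Y₁).toLinearMap LinearMap.id) := by
  ext <;> simp [TensorProduct.tmul_neg, TensorProduct.neg_tmul, -Prod.neg_mk, mk_zero_neg,
    mk_neg_zero]

theorem hexagon_odd :
    (assocAux R Y₀ Y₁ U U' X₁ X₀).toLinearMap ∘ₗ
      (commOdd R X₀ X₁ ((Y₀ ⊗[R] U) × (Y₁ ⊗[R] U'))
        ((Y₀ ⊗[R] U') × (Y₁ ⊗[R] U))).toLinearMap ∘ₗ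
      (assocAux R X₀ X₁ Y₀ Y₁ U' U).toLinearMap =
    (TensorProduct.map LinearMap.id (commOdd R X₀ X₁ U U').toLinearMap).prodMap
        (TensorProduct.map LinearMap.id (commEven R X₀ X₁ U U').toLinearMap) ∘ₗ
      (assocAux R Y₀ Y₁ X₀ X₁ U' U).toLinearMap ∘ₗ
      (TensorProduct.map (commEven R X₀ X₁ Y₀ Y₁).toLinearMap LinearMap.id).prodMap
        (TensorProduct.map (commOdd R X₀ X₁ Y₀ Y₁).toLinearMap LinearMap.id) := by
  ext <;> simp [TensorProduct.tmul_neg, TensorProduct.neg_tmul, -Prod.neg_mk, mk_zero_neg,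
    mk_neg_zero]

end Aux


instance : MonoidalCategoryStruct (SuperVect L) where
  tensorObj V W :=
    { even := (V.even ⊗[L] W.even) × (V.odd ⊗[L] W.odd)
      odd := (V.even ⊗[L] W.odd) × (V.odd ⊗[L] W.even) }
  tensorUnit :=
    { even := L
      odd := PUnit }
  tensorHom f g :=
    ⟨(TensorProduct.map f.even g.even).prodMap (TensorProduct.map f.odd g.odd),
      (TensorProduct.map f.even g.odd).prodMap (TensorProduct.map f.odd g.even)⟩
  whiskerLeft V _ _ g :=
    ⟨(TensorProduct.map LinearMap.id g.even).prodMap (TensorProduct.map LinearMap.id g.odd),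
      (TensorProduct.map LinearMap.id g.odd).prodMap (TensorProduct.map LinearMap.id g.even)⟩
  whiskerRight f W :=
    ⟨(TensorProduct.map f.even LinearMap.id).prodMap (TensorProduct.map f.odd LinearMap.id),
      (TensorProduct.map f.even LinearMap.id).prodMap (TensorProduct.map f.odd LinearMap.id)⟩
  associator V W U := isoMk
    (assocAux L V.even V.odd W.even W.odd U.even U.odd)
    (assocAux L V.even V.odd W.even W.odd U.odd U.even)
  leftUnitor V := isoMk (lUnitAux L V.even V.odd) (lUnitAux L V.odd V.even)
  rightUnitor V := isoMk (rUnitAux L V.even V.odd)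
    (LinearEquiv.prodComm L _ _ ≪≫ₗ rUnitAux L V.odd V.even)

theorem map_id_id (A B : Type w) [AddCommGroup A] [AddCommGroup B] [Module L A] [Module L B]
    (A' B' : Type w) [AddCommGroup A'] [AddCommGroup B'] [Module L A'] [Module L B'] :
    (TensorProduct.map (LinearMap.id : A →ₗ[L] A) (LinearMap.id : B →ₗ[L] B)).prodMap
      (TensorProduct.map (LinearMap.id : A' →ₗ[L] A') (LinearMap.id : B' →ₗ[L] B')) =
      LinearMap.id := by
  simp only [TensorProduct.map_id, LinearMap.prodMap_id]

theorem map_comp_comp {A A' A'' B B' B'' D D' D'' E E' E'' : Type w}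
    [AddCommGroup A] [AddCommGroup A'] [AddCommGroup A''] [AddCommGroup B] [AddCommGroup B']
    [AddCommGroup B''] [AddCommGroup D] [AddCommGroup D'] [AddCommGroup D''] [AddCommGroup E]
    [AddCommGroup E'] [AddCommGroup E''] [Module L A] [Module L A'] [Module L A''] [Module L B]
    [Module L B'] [Module L B''] [Module L D] [Module L D'] [Module L D''] [Module L E]
    [Module L E'] [Module L E'']
    (f : A →ₗ[L] A') (f' : A' →ₗ[L] A'') (g : B →ₗ[L] B') (g' : B' →ₗ[L] B'')
    (h : D →ₗ[L] D') (h' : D' →ₗ[L] D'') (k : E →ₗ[L] E') (k' : E' →ₗ[L] E'') :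
    (TensorProduct.map f' g').prodMap (TensorProduct.map h' k') ∘ₗ
      (TensorProduct.map f g).prodMap (TensorProduct.map h k) =
    (TensorProduct.map (f' ∘ₗ f) (g' ∘ₗ g)).prodMap (TensorProduct.map (h' ∘ₗ h) (k' ∘ₗ k)) := by
  rw [map_prodMap_comp, TensorProduct.map_comp, TensorProduct.map_comp]

instance : MonoidalCategory (SuperVect L) where
  tensorHom_def f g := hom_ext
    (map_comp_comp f.even .id .id g.even f.odd .id .id g.odd).symm
    (map_comp_comp f.even .id .id g.odd f.odd .id .id g.even).symm
  id_tensorHom_id V W := hom_ext (map_id_id V.even W.even V.odd W.odd)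
    (map_id_id V.even W.odd V.odd W.even)
  tensorHom_comp_tensorHom f g f' g' := hom_ext
    (map_comp_comp f.even f'.even g.even g'.even f.odd f'.odd g.odd g'.odd)
    (map_comp_comp f.even f'.even g.odd g'.odd f.odd f'.odd g.even g'.even)
  whiskerLeft_id V W := hom_ext (map_id_id V.even W.even V.odd W.odd)
    (map_id_id V.even W.odd V.odd W.even)
  id_whiskerRight V W := hom_ext (map_id_id V.even W.even V.odd W.odd)
    (map_id_id V.even W.odd V.odd W.even)
  associator_naturality f g h := hom_ext
    (assocAux_naturality L f.even f.odd g.even g.odd h.even h.odd)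
    (assocAux_naturality L f.even f.odd g.even g.odd h.odd h.even)
  leftUnitor_naturality f := hom_ext
    (lUnitAux_naturality L f.even f.odd) (lUnitAux_naturality L f.odd f.even)
  rightUnitor_naturality f := hom_ext
    (rUnitAux_naturality L f.even f.odd) (rUnitAux_naturality' L f.even f.odd)
  pentagon V W X Y := hom_ext
    (assocAux_pentagon L (X₀ := V.even) (X₁ := V.odd) (Y₀ := W.even) (Y₁ := W.odd)
      (Z₀ := X.even) (Z₁ := X.odd) (U := Y.even) (U' := Y.odd))
    (assocAux_pentagon L (X₀ := V.even) (X₁ := V.odd) (Y₀ := W.even) (Y₁ := W.odd)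
      (Z₀ := X.even) (Z₁ := X.odd) (U := Y.odd) (U' := Y.even))
  triangle V W := hom_ext
    (unitAux_triangle L (X₀ := V.even) (X₁ := V.odd) (Y₀ := W.even) (Y₁ := W.odd))
    (unitAux_triangle L (X₀ := V.even) (X₁ := V.odd) (Y₀ := W.odd) (Y₁ := W.even))

/-- The Koszul rule `v ⊗ w ↦ (-1)^{|v| |w|} w ⊗ v`. -/
def koszul (V W : SuperVect L) : V ⊗ W ≅ W ⊗ V :=
  isoMk (commEven L V.even V.odd W.even W.odd) (commOdd L V.even V.odd W.even W.odd)

theorem koszul_symm (V W : SuperVect L) : (koszul V W).hom ≫ (koszul W V).hom = 𝟙 _ :=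
  hom_ext (commEven_symm L) (commOdd_symm L)

theorem koszul_hexagon (X Y Z : SuperVect L) :
    (α_ X Y Z).hom ≫ (koszul X (Y ⊗ Z)).hom ≫ (α_ Y Z X).hom =
      (koszul X Y).hom ▷ Z ≫ (α_ Y X Z).hom ≫ Y ◁ (koszul X Z).hom :=
  hom_ext (hexagon_even L) (hexagon_odd L)

theorem koszul_inv (V W : SuperVect L) : (koszul V W).inv = (koszul W V).hom := by
  rw [← cancel_epi (koszul V W).hom, koszul_symm, Iso.hom_inv_id]

theorem koszul_hexagon' (X Y Z : SuperVect L) :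
    (α_ X Y Z).inv ≫ (koszul (X ⊗ Y) Z).hom ≫ (α_ Z X Y).inv =
      X ◁ (koszul Y Z).hom ≫ (α_ X Z Y).inv ≫ (koszul X Z).hom ▷ Y := by
  have h := koszul_hexagon Z X Y
  have h' : (α_ Z X Y ≪≫ koszul Z (X ⊗ Y) ≪≫ α_ X Y Z).inv =
      (whiskerRightIso (koszul Z X) Y ≪≫ α_ X Z Y ≪≫ whiskerLeftIso X (koszul Z Y)).inv := by
    congr 1
    exact Iso.ext h
  simpa [koszul_inv] using h'

/-- The symmetry of the category of super vector spaces is given by the Koszul rule. -/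
instance : SymmetricCategory (SuperVect L) where
  braiding := koszul
  braiding_naturality_right _ _ _ _ := hom_ext (commEven_naturality L _ _ _ _)
    (commOdd_naturality L _ _ _ _)
  braiding_naturality_left _ _ := hom_ext (commEven_naturality L _ _ _ _)
    (commOdd_naturality L _ _ _ _)
  hexagon_forward := koszul_hexagon
  hexagon_reverse := koszul_hexagon'
  symmetry := koszul_symm

end SuperVect

section Schur
variable {C : Type u} [Category.{v} C] [MonoidalCategory C] [SymmetricCategory C]
  [Preadditive C] (K : Type w) [Field K] [Linear K C]

/-- The action of the group algebra `K[𝔖_n]` on `M^{⊗ n}`. -/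
def groupAlgebraAction (M : C) (n : ℕ) :
    MonoidAlgebra K (Equiv.Perm (Fin n)) →ₐ[K] End (tensorPow M n) :=
  MonoidAlgebra.lift K (End (tensorPow M n)) (Equiv.Perm (Fin n)) (permAction M n)

variable {K}

/-- For an idempotent `e` of `K[𝔖_n]`, the direct factor `e M^{⊗ n}` of `M^{⊗ n}`, as an object of
the pseudo-abelian hull. If `V = K[𝔖_n] e` is the corresponding representation of `𝔖_n`, it
represents `Hom_{𝔖_n}(V, M^{⊗ n})`; so, if `V` is irreducible, this is the value at `M` of the
Schur functor attached to `V`. -/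
def schurObj (M : C) {n : ℕ} {e : MonoidAlgebra K (Equiv.Perm (Fin n))}
    (he : IsIdempotentElem e) : Idempotents.Karoubi C where
  X := tensorPow M n
  p := groupAlgebraAction K M n e
  idem := (he.map (groupAlgebraAction K M n)).eq

variable (K) in
/-- `M` is Schur-finite if it is killed by the Schur functor attached to some irreducible
representation `V = K[𝔖_n] e` of some symmetric group. -/
def SchurFinite (M : C) : Prop :=
  ∃ (n : ℕ) (e : MonoidAlgebra K (Equiv.Perm (Fin n))) (he : IsIdempotentElem e),
    IsSimpleModule (MonoidAlgebra K (Equiv.Perm (Fin n)))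
      (Submodule.span (MonoidAlgebra K (Equiv.Perm (Fin n))) {e}) ∧
    Limits.IsZero (schurObj M he)

end Schur

section ReducedTrace

/-- `e` is a primitive central idempotent. -/
structure IsPrimitiveCentralIdempotent {A : Type v} [Ring A] (e : A) : Prop where
  idem : IsIdempotentElem e
  central : ∀ a, e * a = a * e
  ne_zero : e ≠ 0
  primitive : ∀ c : A, IsIdempotentElem c → (∀ a, c * a = a * c) → c * e = 0 ∨ c * e = e

variable (K : Type w) [Field K]

/-- The `K`-algebra structure of the corner ring `e A e`. -/
instance cornerAlgebra {A : Type v} [Ring A] [Algebra K A] {e : A} (he : IsIdempotentElem e) :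
    Algebra K he.Corner :=
  RingHom.toAlgebra'
    { toFun := fun r => ⟨r • e, r • 1, by simp [he.eq]⟩
      map_one' := Subtype.ext (one_smul K e)
      map_mul' := fun r s => Subtype.ext (show (r * s) • e = r • e * s • e by
        simp [he.eq, mul_smul, smul_comm r s])
      map_zero' := Subtype.ext (zero_smul K e)
      map_add' := fun r s => Subtype.ext (add_smul r s e) }
    (fun r x => Subtype.ext (show r • e * x.1 = x.1 * r • e by
      have h := (Subsemigroup.mem_corner_iff he).mp x.2
      rw [smul_mul_assoc, mul_smul_comm, h.1, h.2]))

/-- The left multiplication by `b`, as a linear map over the centre. -/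
def mulLeftOverCenter (B : Type v) [Ring B] [Algebra K B] (b : B) :
    B →ₗ[Subalgebra.center K B] B where
  toFun x := b * x
  map_add' := mul_add b
  map_smul' z x := by
    have h := Subalgebra.mem_center_iff.mp z.2 b
    show b * (z.1 * x) = z.1 * (b * x)
    rw [← mul_assoc, h, mul_assoc]

/-- The reduced trace `Tr_{Z/K} ∘ Trd_{B/Z}` of a simple algebra `B` with centre `Z`, finite
dimensional over a field `K` of characteristic `0`. If `[B : Z] = d²`, the trace over `Z` of the
left multiplication by `b` on `B` is `d Trd_{B/Z}(b)`. -/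
def reducedTraceOfSimple (B : Type v) [Ring B] [Algebra K B] (b : B) : K :=
  Algebra.trace K (Subalgebra.center K B)
    ((Nat.sqrt (Module.finrank (Subalgebra.center K B) B) : K)⁻¹ •
      LinearMap.trace (Subalgebra.center K B) B (mulLeftOverCenter K B b))

/-- The reduced trace of a finite dimensional semisimple algebra: the sum of the reduced traces of
its simple components, which are the corner rings at the primitive central idempotents. -/
def reducedTrace (A : Type v) [Ring A] [Algebra K A] (a : A) : K :=
  ∑ᶠ e : {e : A // IsPrimitiveCentralIdempotent e},
    reducedTraceOfSimple K e.2.idem.Corner ⟨e.1 * a * e.1, a, rfl⟩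

end ReducedTrace

/-- A rigid `K`-category: a `K`-linear symmetric monoidal category (with `K`-bilinear tensor
product) in which every object has a dual, with `End(𝟙) = K`. By symmetry, left duals are also right
duals. -/
structure RigidCat (K : Type w) [Field K] where
  /-- the underlying type of objects -/
  carrier : Type u
  [category : Category.{v} carrier]
  [preadditive : Preadditive carrier]
  [linear : Linear K carrier]
  [monoidal : MonoidalCategory carrier]
  [symmetric : SymmetricCategory carrier]
  [monoidalPreadditive : MonoidalPreadditive carrier]
  [monoidalLinear : MonoidalLinear K carrier]
  [rigid : LeftRigidCategory carrier]
  end_unit : Function.Bijective (algebraMap K (End (𝟙_ carrier)))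

namespace RigidCat
open TensorProduct

attribute [instance] category preadditive linear monoidal symmetric monoidalPreadditive
  monoidalLinear rigid

instance (K : Type w) [Field K] : CoeSort (RigidCat.{v, u} K) (Type u) := ⟨carrier⟩

variable {K : Type w} [Field K] (A : RigidCat.{v, u} K)

theorem baseChange_end_unit (L : Type w') [Field L] [Algebra K L] :
    Function.Bijective (algebraMap L (End (𝟙_ (ScalarExt K L A)))) := by
  let e : K ≃ₗ[K] (𝟙_ A ⟶ 𝟙_ A) :=
    LinearEquiv.ofBijective (Algebra.linearMap K (End (𝟙_ A))) A.end_unit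
  let e' : L ≃ₗ[K] TensorProduct K L (𝟙_ A ⟶ 𝟙_ A) :=
    (TensorProduct.rid K L).symm ≪≫ₗ TensorProduct.congr (LinearEquiv.refl K L) e
  have : (algebraMap L (End (𝟙_ (ScalarExt K L A))) : L → _) = e' := by
    funext l
    have h : (l • (1 : End (𝟙_ (ScalarExt K L A))) : End (𝟙_ (ScalarExt K L A))) =
        (l * 1) ⊗ₜ[K] 𝟙 (𝟙_ A) := rfl
    rw [Algebra.algebraMap_eq_smul_one, h]
    simp only [mul_one, e', LinearEquiv.trans_apply, TensorProduct.rid_symm_apply,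
      TensorProduct.congr_tmul, LinearEquiv.refl_apply]
    exact congrArg (l ⊗ₜ[K] ·) (map_one (algebraMap K (End (𝟙_ A)))).symm
  rw [this]
  exact e'.bijective

/-- The extension of scalars `A_L`. -/
def baseChange (L : Type w') [Field L] [Algebra K L] : RigidCat.{max w' v, u} L where
  carrier := ScalarExt K L A
  end_unit := A.baseChange_end_unit L

/-- `A` is semisimple: the endomorphism rings of all objects of its additive hull are semisimple. -/
def IsSemisimple : Prop := ∀ M : Mat_ A, IsSemisimpleRing (End M)

/-- `M` is of integral type: there is an endomorphism `μ` of `M` such that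
`tr (f) = Trd (μ f)` for every endomorphism `f` of `M`, whose component in each simple factor of
`End M` is an integer. -/
def IsOfIntegralType (M : A) : Prop :=
  ∃ μ : End M, (∀ f : End M, trace f = algebraMap K (End (𝟙_ A)) (reducedTrace K (End M) (μ * f))) ∧
    ∀ e : End M, IsPrimitiveCentralIdempotent e → ∃ m : ℤ, μ * e = m • e

/-- Every object of `A` becomes of integral type over an algebraic closure of `K`. -/
def IsGeometricallyOfIntegralType : Prop :=
  ∀ M : A, (A.baseChange (AlgebraicClosure K)).IsOfIntegralType ⟨M⟩

/-- There is a tensor functor (`K`-linear symmetric monoidal) from `A` to the super vector spaces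
over some extension `L` of `K`. -/
def IsOfHomologicalType : Prop :=
  ∃ (L : Type w') (_ : Field L) (_ : Algebra K L) (H : A ⥤ SuperVect L),
    H.Additive ∧ (∀ (X Y : A) (r : K) (f : X ⟶ Y), H.map (r • f) = algebraMap K L r • H.map f) ∧
    Nonempty H.Braided

/-- `A` is semisimple and tensor equivalent to the quotient of a rigid `K`-category `B` of
homological type by the ideal of morphisms universally of trace zero. -/
def IsOfHomologicalOrigin : Prop :=
  A.IsSemisimple ∧
  ∃ B : RigidCat.{v', u'} K, IsOfHomologicalType.{v', u', w, w'} B ∧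
    ∃ E : NumQuotient B ⥤ A, E.IsEquivalence ∧ E.Additive ∧ E.Linear K ∧ Nonempty E.Braided

end RigidCat

end TensorCat

end

/-!
By assumption, `A` is equivalent to the quotient of a rigid category `B` by the morphisms universally
of trace zero, and there is a tensor functor `H` from `B` to super vector spaces over `L`. Write `P`
for the resulting functor `B ⥤ A`. Everything follows from one observation. If `P` maps `N` to an
object isomorphic to `M`, then `End N` maps onto `End M`, and since braided functors preserve traces
(`pairingTrace_map`), whichever dual is used to compute them (`pairingTrace_comp_comm`), the trace
form of `M` becomes on `End N` the supertrace of the action of `End N` on `H N`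
(`SuperVect.pairingTrace_even`). Moreover the trace form of `M` is nondegenerate, by definition of
the ideal of morphisms universally of trace zero (`RigidCat.eq_zero_of_scalarTrace_mul`).

*Schur-finiteness.* By nondegeneracy, endomorphisms of `N` whose images in `End M` are linearly
independent over `K` act on `H N` by operators that are linearly independent over `L`
(`linearIndependent_of_realization`). So the dimension of `End M` is at most the square of the total
dimension `d` of `H N`, and that of `End (M^{⊗ n})` at most `d ^ (2 * n)`. This is less than `n!`
for large `n`, so `K[𝔖_n]` does not act faithfully on `M^{⊗ n}`, and by Maschke's theorem the kernel of
the action contains a simple left ideal, generated by an idempotent.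

*Integrality.* Let `F` be an algebraic closure of `K`. An idempotent of `F ⊗ End M` lifts, over
an algebraic closure `Ω` of `L`, to an element of `Ω ⊗ End N` whose action on the extension of `H N`
to `Ω` is idempotent, by a polynomial argument (`exists_lift_isIdempotentElem`). Its trace is thus a
difference of two ranks, hence an integer. In the same way nilpotent elements of `F ⊗ End M` have
trace zero, so by nondegeneracy `F ⊗ End M` is semisimple, a product of matrix algebras. On each
factor the trace form is a multiple of the matrix trace, and the multiple is the trace of an
idempotent of rank one, an integer (`exists_integral_multiplier`).
-/

noncomputable section

namespace TensorCat

/-! ### Traces and braided functors -/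

section PairingTrace

open Functor.LaxMonoidal Functor.OplaxMonoidal

variable {C : Type u} [Category.{v} C] [MonoidalCategory C] [SymmetricCategory C]

/-- The trace of an endomorphism of `X`, computed with an arbitrary dual `D` of `X`. -/
def pairingTrace (D : C) {X : C} [ExactPairing D X] (f : X ⟶ X) : End (𝟙_ C) :=
  η_ D X ≫ D ◁ f ≫ (β_ D X).hom ≫ ε_ D X

/-- The trace is cyclic, whichever duals of the two objects are used. For `g = 𝟙` this is also the
independence of the trace from the dual. -/
theorem pairingTrace_comp_comm (D D' : C) {X Y : C} [ExactPairing D X] [ExactPairing D' Y]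
    (f : X ⟶ Y) (g : Y ⟶ X) : pairingTrace D (f ≫ g) = pairingTrace D' (g ≫ f) := by
  -- the mate of `f` for the two given dualities
  obtain ⟨m, h₁, h₂⟩ : ∃ m : D' ⟶ D, η_ D X ≫ D ◁ f = η_ D' Y ≫ m ▷ Y ∧
      X ◁ m ≫ ε_ D X = f ▷ D' ≫ ε_ D' Y := by
    let _ : HasLeftDual X := ⟨D⟩
    let _ : HasLeftDual Y := ⟨D'⟩
    exact ⟨(ᘁf), (coevaluation_comp_leftAdjointMate f).symm, leftAdjointMate_comp_evaluation f⟩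
  unfold pairingTrace
  rw [MonoidalCategory.whiskerLeft_comp, Category.assoc, reassoc_of% h₁,
    ← whisker_exchange_assoc, BraidedCategory.braiding_naturality_left_assoc, h₂]
  simp

variable {C' : Type u'} [Category.{v'} C'] [MonoidalCategory C']

/-- A monoidal functor maps an exact pairing to an exact pairing. -/
@[reducible]
def mapExactPairing (F : C ⥤ C') [F.Monoidal] (D X : C) [ExactPairing D X] :
    ExactPairing (F.obj D) (F.obj X) where
  coevaluation' := ε F ≫ F.map (η_ D X) ≫ δ F _ _
  evaluation' := μ F _ _ ≫ F.map (ε_ D X) ≫ η F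
  coevaluation_evaluation' := by
    have h := congrArg F.map (ExactPairing.coevaluation_evaluation D X)
    simp only [Functor.map_comp] at h
    simp only [Functor.Monoidal.map_rightUnitor, Functor.Monoidal.map_leftUnitor_inv,
      Functor.Monoidal.map_whiskerLeft, Functor.Monoidal.map_whiskerRight,
      Functor.Monoidal.map_associator_inv, Category.assoc,
      Functor.Monoidal.μ_δ_assoc, cancel_epi] at h
    simpa [-μ_natural_left, -μ_natural_right] using
      congrArg (fun k => F.obj X ◁ ε F ≫ k ≫ δ F (𝟙_ C) X ≫ η F ▷ F.obj X) h
  evaluation_coevaluation' := by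
    have h := congrArg F.map (ExactPairing.evaluation_coevaluation D X)
    simp only [Functor.map_comp] at h
    simp only [Functor.Monoidal.map_leftUnitor, Functor.Monoidal.map_rightUnitor_inv,
      Functor.Monoidal.map_whiskerLeft, Functor.Monoidal.map_whiskerRight,
      Functor.Monoidal.map_associator, Category.assoc,
      Functor.Monoidal.μ_δ_assoc, cancel_epi] at h
    simpa [-μ_natural_left, -μ_natural_right] using
      congrArg (fun k => ε F ▷ F.obj D ≫ k ≫ δ F D (𝟙_ C) ≫ F.obj D ◁ η F) h

/-- A braided monoidal functor is compatible with traces. -/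
theorem pairingTrace_map [SymmetricCategory C'] (F : C ⥤ C') [F.Braided] (D : C) {X : C}
    [ExactPairing D X] (f : X ⟶ X) :
    letI := mapExactPairing F D X
    pairingTrace (F.obj D) (F.map f) = ε F ≫ F.map (pairingTrace D f) ≫ η F := by
  let _ := mapExactPairing F D X
  have h₁ : η_ (F.obj D) (F.obj X) = ε F ≫ F.map (η_ D X) ≫ δ F _ _ := rfl
  have h₂ : ε_ (F.obj D) (F.obj X) = μ F _ _ ≫ F.map (ε_ D X) ≫ η F := rfl
  unfold pairingTrace
  rw [h₁, h₂]
  have h₃ : δ F D X ≫ (β_ (F.obj D) (F.obj X)).hom ≫ μ F X D = F.map (β_ D X).hom := by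
    rw [← Functor.LaxBraided.braided, Functor.Monoidal.δ_μ_assoc]
  simp only [Functor.map_comp, Category.assoc]
  congr 2
  rw [Functor.OplaxMonoidal.δ_natural_right_assoc, reassoc_of% h₃]

end PairingTrace

/-! ### The trace of super vector spaces -/

section Contraction
open TensorProduct

variable {L : Type*} [CommRing L] {V D : Type*} [AddCommGroup V] [Module L V]
  [AddCommGroup D] [Module L D]

/-- The endomorphism `v ↦ ∑ b (v ⊗ dᵢ) wᵢ` of `V` attached to a pairing `b : V ⊗ D → L` and a
tensor `∑ dᵢ ⊗ wᵢ` of `D ⊗ V`. -/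
def contractWith (b : V ⊗[L] D →ₗ[L] L) : D ⊗[L] V →ₗ[L] Module.End L V :=
  dualTensorHom L V V ∘ₗ (TensorProduct.curry b).flip.rTensor V

@[simp]
theorem contractWith_tmul (b : V ⊗[L] D →ₗ[L] L) (d : D) (w v : V) :
    contractWith b (d ⊗ₜ w) v = b (v ⊗ₜ d) • w := by
  simp [contractWith]

theorem trace_mul_contractWith [Module.Free L V] [Module.Finite L V] (b : V ⊗[L] D →ₗ[L] L)
    (f : V →ₗ[L] V) (x : D ⊗[L] V) :
    LinearMap.trace L V (f * contractWith b x) =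
      b (TensorProduct.comm L D V (TensorProduct.map LinearMap.id f x)) := by
  induction x using TensorProduct.induction_on with
  | zero => simp
  | add x y hx hy => simp only [map_add, mul_add, hx, hy]
  | tmul d w =>
    have : f * contractWith b (d ⊗ₜ w) =
        LinearMap.smulRight ((TensorProduct.curry b).flip d) (f w) := by
      ext v; simp
    rw [this, LinearMap.trace_smulRight]
    simp

end Contraction

namespace SuperVect
open TensorProduct
variable {L : Type w} [Field L]

/-- The duality equation on the even part: the even part of the coevaluation contracts to the
identity. -/
theorem contractWith_coevaluation_even (D V : SuperVect L) [ExactPairing D V] :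
    contractWith ((ε_ D V).even ∘ₗ LinearMap.inl L (V.even ⊗[L] D.even) (V.odd ⊗[L] D.odd))
      ((η_ D V).even (1 : L)).1 = 1 := by
  have key (v : V.even) : (lUnitAux L V.even V.odd).toLinearMap ∘ₗ (ε_ D V ▷ V).even ∘ₗ
        (assocAux L V.even V.odd D.even D.odd V.even V.odd).symm.toLinearMap ∘ₗ
        LinearMap.inl L _ _ ∘ₗ TensorProduct.mk L V.even _ v =
      (contractWith ((ε_ D V).even ∘ₗ LinearMap.inl L _ _)).flip v ∘ₗ LinearMap.fst L _ _ := by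
    refine LinearMap.prod_ext (TensorProduct.ext' fun d w => ?_) (TensorProduct.ext' fun d w => ?_)
    · simp only [LinearMap.comp_apply, LinearMap.inl_apply, TensorProduct.mk_apply,
        LinearEquiv.coe_coe]
      rw [← assocAux_00, LinearEquiv.symm_apply_apply]
      change TensorProduct.lid L V.even ((ε_ D V).even (v ⊗ₜ d, 0) ⊗ₜ w) = _
      simp only [lid_tmul, LinearMap.flip_apply, LinearMap.fst_apply, contractWith_tmul]
      rfl
    · simp only [LinearMap.comp_apply, LinearMap.inl_apply, LinearMap.inr_apply,
        TensorProduct.mk_apply, LinearEquiv.coe_coe]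
      rw [← assocAux_01, LinearEquiv.symm_apply_apply]
      simp only [LinearMap.fst_apply, map_zero]
      change TensorProduct.lid L V.even ((ε_ D V ▷ V).even (0, (v ⊗ₜ d, 0) ⊗ₜ w)).1 = 0
      have : (ε_ D V ▷ V).even (0, (v ⊗ₜ d, 0) ⊗ₜ w) = (0, (ε_ D V).odd (v ⊗ₜ d, 0) ⊗ₜ w) := by
        exact Prod.ext (map_zero (TensorProduct.map (ε_ D V).even LinearMap.id)) rfl
      rw [this]; simp
  ext v
  have h := congrArg Hom.even (ExactPairing.coevaluation_evaluation D V)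
  have h' := congrArg (lUnitAux L V.even V.odd) (LinearMap.congr_fun h
    ((v ⊗ₜ (1 : L), 0) : (V.even ⊗[L] L) × (V.odd ⊗[L] PUnit.{w + 1})))
  refine (LinearMap.congr_fun (key v) ((η_ D V).even (1 : L))).symm.trans ?_
  refine Eq.trans ?_ (h'.trans ?_)
  · change lUnitAux L V.even V.odd ((ε_ D V ▷ V).even
        ((assocAux L V.even V.odd D.even D.odd V.even V.odd).symm _)) =
       lUnitAux L V.even V.odd ((ε_ D V ▷ V).even
        ((assocAux L V.even V.odd D.even D.odd V.even V.odd).symm _))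
    congr 3
  · change lUnitAux L V.even V.odd ((lUnitAux L V.even V.odd).symm (rUnitAux L V.even V.odd
      (v ⊗ₜ (1 : L), 0))) = _
    simp

/-- The duality equation on the odd part: the odd part of the coevaluation contracts to the
identity. -/
theorem contractWith_coevaluation_odd (D V : SuperVect L) [ExactPairing D V] :
    contractWith ((ε_ D V).even ∘ₗ LinearMap.inr L (V.even ⊗[L] D.even) (V.odd ⊗[L] D.odd))
      ((η_ D V).even (1 : L)).2 = 1 := by
  have key (v : V.odd) : (lUnitAux L V.odd V.even).toLinearMap ∘ₗ (ε_ D V ▷ V).odd ∘ₗ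
        (assocAux L V.even V.odd D.even D.odd V.odd V.even).symm.toLinearMap ∘ₗ
        LinearMap.inr L _ _ ∘ₗ TensorProduct.mk L V.odd _ v =
      (contractWith ((ε_ D V).even ∘ₗ LinearMap.inr L _ _)).flip v ∘ₗ LinearMap.snd L _ _ := by
    refine LinearMap.prod_ext (TensorProduct.ext' fun d w => ?_) (TensorProduct.ext' fun d w => ?_)
    · simp only [LinearMap.comp_apply, LinearMap.inl_apply, LinearMap.inr_apply,
        TensorProduct.mk_apply, LinearEquiv.coe_coe]
      rw [← assocAux_10, LinearEquiv.symm_apply_apply]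
      simp only [LinearMap.snd_apply, map_zero]
      change TensorProduct.lid L V.odd ((ε_ D V ▷ V).odd (0, (0, v ⊗ₜ d) ⊗ₜ w)).1 = 0
      have : (ε_ D V ▷ V).odd (0, (0, v ⊗ₜ d) ⊗ₜ w) = (0, (ε_ D V).odd (0, v ⊗ₜ d) ⊗ₜ w) := by
        exact Prod.ext (map_zero (TensorProduct.map (ε_ D V).even LinearMap.id)) rfl
      rw [this]; simp
    · simp only [LinearMap.comp_apply, LinearMap.inr_apply, TensorProduct.mk_apply,
        LinearEquiv.coe_coe]
      rw [← assocAux_11, LinearEquiv.symm_apply_apply]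
      change TensorProduct.lid L V.odd ((ε_ D V).even (0, v ⊗ₜ d) ⊗ₜ w) = _
      simp only [lid_tmul, LinearMap.flip_apply, LinearMap.snd_apply, contractWith_tmul]
      rfl
  ext v
  have h := congrArg Hom.odd (ExactPairing.coevaluation_evaluation D V)
  have h' := congrArg (lUnitAux L V.odd V.even) (LinearMap.congr_fun h
    ((0, v ⊗ₜ (1 : L)) : (V.even ⊗[L] PUnit.{w + 1}) × (V.odd ⊗[L] L)))
  refine (LinearMap.congr_fun (key v) ((η_ D V).even (1 : L))).symm.trans ?_
  refine Eq.trans ?_ (h'.trans ?_)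
  · change lUnitAux L V.odd V.even ((ε_ D V ▷ V).odd
        ((assocAux L V.even V.odd D.even D.odd V.odd V.even).symm _)) =
       lUnitAux L V.odd V.even ((ε_ D V ▷ V).odd
        ((assocAux L V.even V.odd D.even D.odd V.odd V.even).symm _))
    congr 3
  · change lUnitAux L V.odd V.even ((lUnitAux L V.odd V.even).symm (rUnitAux L V.odd V.even
      (v ⊗ₜ (1 : L), 0))) = _
    simp

/-- The trace in the category of super vector spaces is the supertrace. -/
theorem pairingTrace_even (D V : SuperVect L) [ExactPairing D V] (f : V ⟶ V) :
    (pairingTrace D f).even (1 : L) =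
      LinearMap.trace L V.even f.even - LinearMap.trace L V.odd f.odd := by
  have h₀ := trace_mul_contractWith ((ε_ D V).even ∘ₗ
    LinearMap.inl L (V.even ⊗[L] D.even) (V.odd ⊗[L] D.odd)) f.even ((η_ D V).even (1 : L)).1
  have h₁ := trace_mul_contractWith ((ε_ D V).even ∘ₗ
    LinearMap.inr L (V.even ⊗[L] D.even) (V.odd ⊗[L] D.odd)) f.odd ((η_ D V).even (1 : L)).2
  rw [contractWith_coevaluation_even, mul_one] at h₀
  rw [contractWith_coevaluation_odd, mul_one] at h₁
  rw [h₀, h₁]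
  refine Eq.trans ?_ (map_sub (ε_ D V).even _ _)
  change (ε_ D V).even (commEven L D.even D.odd V.even V.odd
    (TensorProduct.map LinearMap.id f.even ((η_ D V).even (1 : L)).1,
      TensorProduct.map LinearMap.id f.odd ((η_ D V).even (1 : L)).2)) = _
  congr 1
  exact Prod.ext (sub_zero _).symm (zero_sub _).symm

end SuperVect

/-! ### Linear forms realized by supertraces -/

section Realization

variable {K L R S : Type*} [Field K] [Field L] [Algebra K L] [Ring R] [Ring S]
  [Algebra K S]

/-- Suppose that a nondegenerate linear form `t` on `S` becomes, on a ring `R` mapping onto `S`,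
the restriction of a linear form on an algebra `W` over an extension `L` of `K`. Then elements of
`R` that are linearly independent over `K` in `S` are linearly independent over `L` in `W`. -/
theorem linearIndependent_of_realization {W : Type*} [Ring W] [Algebra L W] (π : R →+* S)
    (hπ : Function.Surjective π) (t : S →ₗ[K] K) (ht : ∀ s, (∀ s', t (s * s') = 0) → s = 0)
    (Φ : R →+* W) (θ : W →ₗ[L] L) (hθ : ∀ r, θ (Φ r) = algebraMap K L (t (π r)))
    {ι : Type*} {r : ι → R} (hr : LinearIndependent K (π ∘ r)) :
    LinearIndependent L (Φ ∘ r) := by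
  rw [linearIndependent_iff'] at hr ⊢
  intro s l hl i hi
  -- test the relation against `Φ r'` and take coordinates in a basis of `L` over `K`
  let b := Module.Basis.ofVectorSpace K L
  have hb : ∀ k, b.coord k (l i) = 0 := fun k => by
    refine hr s (fun i => b.coord k (l i)) (ht _ fun s' => ?_) i hi
    obtain ⟨r', rfl⟩ := hπ s'
    have h := congrArg (fun x => b.coord k (θ (x * Φ r'))) hl
    simp only [Function.comp_apply, Finset.sum_mul, smul_mul_assoc, map_sum, map_smul,
      ← map_mul, hθ, zero_mul, map_zero, smul_eq_mul] at h ⊢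
    refine Eq.trans (Finset.sum_congr rfl fun j _ => ?_) h
    rw [mul_comm (l j), ← Algebra.smul_def, map_smul, smul_eq_mul, mul_comm, map_mul]
  exact b.repr.injective (Finsupp.ext fun k => by simpa using hb k)

end Realization

section Lifting

open Polynomial

variable {k R S W : Type*} [Field k] [Ring R] [Algebra k R] [Ring S] [Algebra k S]
  [Ring W] [Algebra k W] [FiniteDimensional k W]

/-- If `R` maps onto `S` and to a finite dimensional algebra `W`, an idempotent of `S` can be lifted
to an element of `R` whose image in `W` is idempotent too: apply to any lift a polynomial `P` with
`P (0) = 0` and `P (1) = 1` for which `P (P - 1)` kills the image in `W`. -/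
theorem exists_lift_isIdempotentElem (π : R →ₐ[k] S) (hπ : Function.Surjective π) (Φ : R →ₐ[k] W)
    {e : S} (he : IsIdempotentElem e) : ∃ y, π y = e ∧ IsIdempotentElem (Φ y) := by
  obtain ⟨x, rfl⟩ := hπ e
  have hX : IsIntegral k (Φ x) := Algebra.IsIntegral.isIntegral _
  obtain ⟨g, hg, hg1⟩ := (minpoly k (Φ x)).exists_eq_pow_rootMultiplicity_mul_and_not_dvd
    (minpoly.ne_zero hX) 1
  set b := (minpoly k (Φ x)).rootMultiplicity 1
  obtain ⟨u, v, huv⟩ : IsCoprime ((X - C (1 : k)) ^ (b + 1)) (X * g) := by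
    refine IsCoprime.pow_left (IsCoprime.mul_right ?_ ?_)
    · have := isCoprime_X_sub_C_of_isUnit_sub (a := (1 : k)) (b := 0) (by simp)
      simpa using this
    · exact (irreducible_X_sub_C (1 : k)).coprime_iff_not_dvd.mpr hg1
  refine ⟨aeval x (v * (X * g)), ?_, ?_⟩
  · -- `P = v * (X * g)` has `P (0) = 0` and `P (1) = 1`, so `P` fixes the idempotent `π x`
    have h1 : π x * aeval (π x) (1 - v * (X * g)) = 0 := by
      have h0 : π x * (π x - 1) = 0 := by rw [mul_sub, he.eq, mul_one, sub_self]
      have : X * (1 - v * (X * g)) = X * (X - C 1) * (u * (X - C 1) ^ b) := by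
        rw [← huv]; ring
      have h2 := congrArg (aeval (π x)) this
      rw [map_mul, aeval_X, map_mul, map_mul, aeval_X, map_sub _ X, aeval_X, aeval_C, map_one, h0,
        zero_mul] at h2
      exact h2
    have h2 : π x * aeval (π x) (v * (X * g)) = aeval (π x) (v * (X * g)) := by
      have : v * (X * g) = X * (v * g) := by ring
      rw [this, map_mul, aeval_X, ← mul_assoc, he.eq]
    rw [map_sub, mul_sub, h2, map_one, mul_one, sub_eq_zero] at h1
    rw [← aeval_algHom_apply, ← h1]
  · have h1 : (v * (X * g)) * (v * (X * g)) - v * (X * g) =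
        minpoly k (Φ x) * (- u * v * X * (X - C 1)) := by
      rw [hg]
      linear_combination (v * X * g) * huv
    have h2 := congrArg (aeval (Φ x)) h1
    rw [map_mul _ (minpoly _ _), minpoly.aeval, zero_mul, map_sub, sub_eq_zero, map_mul] at h2
    rw [← aeval_algHom_apply]
    exact h2

/-- The analogue of `exists_lift_isIdempotentElem` for nilpotent elements: multiply any lift `x` by
a polynomial in `x` that maps to `1` in `S` and kills the part of `W` where `x` is invertible. -/
theorem exists_lift_isNilpotent (π : R →ₐ[k] S) (hπ : Function.Surjective π) (Φ : R →ₐ[k] W)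
    {e : S} (he : IsNilpotent e) : ∃ y, π y = e ∧ IsNilpotent (Φ y) := by
  obtain ⟨x, rfl⟩ := hπ e
  obtain ⟨N, hN⟩ := he
  have hX : IsIntegral k (Φ x) := Algebra.IsIntegral.isIntegral _
  obtain ⟨g, hg, hg0⟩ := (minpoly k (Φ x)).exists_eq_pow_rootMultiplicity_mul_and_not_dvd
    (minpoly.ne_zero hX) 0
  set a := (minpoly k (Φ x)).rootMultiplicity 0
  rw [map_zero, sub_zero] at hg hg0
  obtain ⟨u, v, huv⟩ : IsCoprime ((X : k[X]) ^ N) g :=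
    IsCoprime.pow_left (irreducible_X.coprime_iff_not_dvd.mpr hg0)
  refine ⟨aeval x (X * (v * g)), ?_, a + 1, ?_⟩
  · have h := congrArg (aeval (π x)) huv
    rw [map_add, map_mul _ u, map_pow, aeval_X, hN, mul_zero, zero_add, map_one] at h
    rw [← aeval_algHom_apply, map_mul, h, aeval_X, mul_one]
  · have h1 : (X * (v * g)) ^ (a + 1) = minpoly k (Φ x) * (X * v ^ (a + 1) * g ^ a) := by
      rw [hg]; ring
    rw [← aeval_algHom_apply, ← map_pow, h1, map_mul, minpoly.aeval, zero_mul]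

end Lifting

section BaseChange

open TensorProduct

variable {K S F : Type*} [Field K] [Ring S] [Algebra K S] [Field F] [Algebra K F]

/-- The `F`-linear extension to `F ⊗ S` of a linear form on `S`. -/
def extendForm (F : Type*) [Field F] [Algebra K F] (t : S →ₗ[K] K) : F ⊗[K] S →ₗ[F] F :=
  (AlgebraTensorModule.rid K F F).toLinearMap ∘ₗ t.baseChange F

@[simp]
theorem extendForm_tmul (t : S →ₗ[K] K) (f : F) (s : S) :
    extendForm F t (f ⊗ₜ s) = t s • f := by
  simp [extendForm]

theorem extendForm_mul_comm {t : S →ₗ[K] K} (ht : ∀ a b, t (a * b) = t (b * a))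
    (x y : F ⊗[K] S) : extendForm F t (x * y) = extendForm F t (y * x) := by
  induction x using TensorProduct.induction_on with
  | zero => simp
  | add x x' hx hx' => simp only [add_mul, mul_add, map_add, hx, hx']
  | tmul a s =>
    induction y using TensorProduct.induction_on with
    | zero => simp
    | add y y' hy hy' => simp only [add_mul, mul_add, map_add, hy, hy']
    | tmul b s' => simp [ht s s', mul_comm a b]

theorem extendForm_nondegenerate {t : S →ₗ[K] K} (ht : ∀ s, (∀ s', t (s * s') = 0) → s = 0)
    (x : F ⊗[K] S) (hx : ∀ y, extendForm F t (x * y) = 0) : x = 0 := by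
  classical
  let b := Module.Basis.ofVectorSpace K F
  have key : ∀ (s' : S) i, t (equivFinsuppOfBasisLeft b x i * s') =
      b.coord i (extendForm F t (x * 1 ⊗ₜ s')) := by
    intro s' i
    clear hx
    induction x using TensorProduct.induction_on with
    | zero => simp
    | add x x' hx hx' => simp only [map_add, add_mul, Finsupp.add_apply, hx, hx']
    | tmul a s => simp [mul_comm]
  refine (equivFinsuppOfBasisLeft b).injective (Finsupp.ext fun i => ?_)
  rw [map_zero]
  exact ht _ fun s' => by rw [key, hx, map_zero]

theorem extendForm_map {Ω : Type*} [Field Ω] [Algebra K Ω] (j : F →ₐ[K] Ω) (t : S →ₗ[K] K)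
    (x : F ⊗[K] S) :
    extendForm Ω t (Algebra.TensorProduct.map j (AlgHom.id K S) x) = j (extendForm F t x) := by
  induction x using TensorProduct.induction_on with
  | zero => simp
  | add x x' hx hx' => simp only [map_add, hx, hx']
  | tmul a s => simp

theorem exists_trace_eq_natCast_of_isIdempotentElem {k : Type*} [Field k] {n : ℕ}
    {M : Matrix (Fin n) (Fin n) k} (hM : IsIdempotentElem M) : ∃ m : ℕ, M.trace = m := by
  have h : IsIdempotentElem (Matrix.toLin' M) := hM.map Matrix.toLinAlgEquiv'
  exact ⟨_, (Matrix.trace_toLin'_eq M).symm.trans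
    (LinearMap.IsIdempotentElem.isProj_range _ h).trace⟩

variable {R Ω : Type*} [Ring R] [Algebra K R] [Field Ω] [Algebra K Ω] {p q : ℕ}

/-- After extension of scalars to `Ω`, the extension of the form is still a supertrace. -/
theorem exists_extend_realization {π : R →ₐ[K] S} (hπ : Function.Surjective π) {t : S →ₗ[K] K}
    {Φ₀ : R →ₐ[K] Matrix (Fin p) (Fin p) Ω} {Φ₁ : R →ₐ[K] Matrix (Fin q) (Fin q) Ω}
    (h : ∀ r, algebraMap K Ω (t (π r)) = (Φ₀ r).trace - (Φ₁ r).trace) :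
    ∃ (ϖ : Ω ⊗[K] R →ₐ[Ω] Ω ⊗[K] S)
      (Ψ : Ω ⊗[K] R →ₐ[Ω] Matrix (Fin p) (Fin p) Ω × Matrix (Fin q) (Fin q) Ω),
      Function.Surjective ϖ ∧
        ∀ y, extendForm Ω t (ϖ y) = (Ψ y).1.trace - (Ψ y).2.trace := by
  let Ψ₀ : Ω ⊗[K] R →ₐ[Ω] _ := Algebra.TensorProduct.lift (Algebra.ofId Ω _) Φ₀
    (fun a _ => Algebra.commutes a _)
  let Ψ₁ : Ω ⊗[K] R →ₐ[Ω] _ := Algebra.TensorProduct.lift (Algebra.ofId Ω _) Φ₁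
    (fun a _ => Algebra.commutes a _)
  refine ⟨Algebra.TensorProduct.map (AlgHom.id Ω Ω) π, Ψ₀.prod Ψ₁, fun z => ?_, fun y => ?_⟩
  · induction z using TensorProduct.induction_on with
    | zero => exact ⟨0, map_zero _⟩
    | add x y hx hy =>
      obtain ⟨⟨x, rfl⟩, ⟨y, rfl⟩⟩ := And.intro hx hy
      exact ⟨x + y, map_add _ _ _⟩
    | tmul a s =>
      obtain ⟨r, rfl⟩ := hπ s
      exact ⟨a ⊗ₜ r, Algebra.TensorProduct.map_tmul _ _ _ _⟩
  induction y using TensorProduct.induction_on with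
  | zero => simp
  | add x x' hx hx' =>
    simp only [map_add, hx, hx', Prod.fst_add, Prod.snd_add, Matrix.trace_add]
    ring
  | tmul a s =>
    have h₀ : Ψ₀ (a ⊗ₜ s) = a • Φ₀ s :=
      (Algebra.TensorProduct.lift_tmul _ _ _ a s).trans (Algebra.smul_def a (Φ₀ s)).symm
    have h₁ : Ψ₁ (a ⊗ₜ s) = a • Φ₁ s :=
      (Algebra.TensorProduct.lift_tmul _ _ _ a s).trans (Algebra.smul_def a (Φ₁ s)).symm
    simp only [AlgHom.prod_apply, h₀, h₁, Matrix.trace_smul, ← smul_sub, ← h]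
    simp [Algebra.smul_def, mul_comm]

/-- Suppose that a linear form `t` on `S` becomes, on an algebra `R` mapping onto `S`, the
supertrace of a representation of `R` on a finite-dimensional super vector space over an extension
`Ω` of `K`. Then `t` has integral values on the idempotents of `S`, even after an extension of
scalars, as the rank of an idempotent matrix is an integer. -/
theorem exists_extendForm_eq_intCast (j : F →ₐ[K] Ω)
    {π : R →ₐ[K] S} (hπ : Function.Surjective π) {t : S →ₗ[K] K}
    {Φ₀ : R →ₐ[K] Matrix (Fin p) (Fin p) Ω} {Φ₁ : R →ₐ[K] Matrix (Fin q) (Fin q) Ω}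
    (h : ∀ r, algebraMap K Ω (t (π r)) = (Φ₀ r).trace - (Φ₁ r).trace)
    {e : F ⊗[K] S} (he : IsIdempotentElem e) : ∃ m : ℤ, extendForm F t e = m := by
  obtain ⟨ϖ, Ψ, hϖ, hΨ⟩ := exists_extend_realization hπ h
  obtain ⟨y, hy, hy'⟩ := exists_lift_isIdempotentElem ϖ hϖ Ψ
    (he.map (Algebra.TensorProduct.map j (AlgHom.id K S)))
  obtain ⟨a, ha⟩ := exists_trace_eq_natCast_of_isIdempotentElem (congrArg Prod.fst hy'.eq)
  obtain ⟨b, hb⟩ := exists_trace_eq_natCast_of_isIdempotentElem (congrArg Prod.snd hy'.eq)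
  refine ⟨a - b, j.toRingHom.injective ?_⟩
  change j _ = j _
  rw [← extendForm_map, ← hy, hΨ, ha, hb]
  simp

/-- In the situation of `exists_extendForm_eq_intCast`, the form vanishes on nilpotent elements. -/
theorem extendForm_eq_zero_of_isNilpotent (j : F →ₐ[K] Ω)
    {π : R →ₐ[K] S} (hπ : Function.Surjective π) {t : S →ₗ[K] K}
    {Φ₀ : R →ₐ[K] Matrix (Fin p) (Fin p) Ω} {Φ₁ : R →ₐ[K] Matrix (Fin q) (Fin q) Ω}
    (h : ∀ r, algebraMap K Ω (t (π r)) = (Φ₀ r).trace - (Φ₁ r).trace)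
    {e : F ⊗[K] S} (he : IsNilpotent e) : extendForm F t e = 0 := by
  obtain ⟨ϖ, Ψ, hϖ, hΨ⟩ := exists_extend_realization hπ h
  obtain ⟨y, hy, hy'⟩ := exists_lift_isNilpotent ϖ hϖ Ψ
    (he.map (Algebra.TensorProduct.map j (AlgHom.id K S)))
  have h₀ := (Matrix.isNilpotent_trace_of_isNilpotent (hy'.map (RingHom.fst _ _))).eq_zero
  have h₁ := (Matrix.isNilpotent_trace_of_isNilpotent (hy'.map (RingHom.snd _ _))).eq_zero
  refine j.toRingHom.injective ?_
  change j _ = j _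
  rw [← extendForm_map, ← hy, hΨ, map_zero]
  exact (congrArg₂ (· - ·) h₀ h₁).trans (sub_zero 0)

end BaseChange

/-! ### Reduced traces of products of matrix algebras -/

section ReducedTraceMatrix

/-- A trace-like linear form on matrices is a multiple of the trace. -/
theorem eq_mul_trace_of_mul_comm {k ι : Type*} [Field k] [Fintype ι] [DecidableEq ι]
    (τ : Matrix ι ι k →ₗ[k] k) (hτ : ∀ a b, τ (a * b) = τ (b * a)) (i₀ : ι)
    (a : Matrix ι ι k) : τ a = τ (Matrix.single i₀ i₀ 1) * a.trace := by
  have key : ∀ i j, τ (Matrix.single i j (a i j)) =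
      if i = j then τ (Matrix.single i₀ i₀ 1) * a i i else 0 := by
    intro i j
    split_ifs with h
    · subst h
      have h₁ : Matrix.single i i (a i i) = Matrix.single i i₀ (a i i) * Matrix.single i₀ i 1 := by
        simp
      have h₂ : Matrix.single i₀ i 1 * Matrix.single i i₀ (a i i) =
          a i i • Matrix.single i₀ i₀ 1 := by
        simp [Matrix.smul_single]
      rw [h₁, hτ, h₂, map_smul, smul_eq_mul, mul_comm]
    · have h₁ : Matrix.single i j (a i j) = Matrix.single i i 1 * Matrix.single i j (a i j) := by
        simp
      rw [h₁, hτ, Matrix.single_mul_single_of_ne _ _ _ _ (Ne.symm h), map_zero]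
  conv_lhs => rw [Matrix.matrix_eq_sum_single a]
  simp only [map_sum, key, Finset.sum_ite_eq, Finset.mem_univ, if_true, Matrix.trace,
    Matrix.diag_apply, Finset.mul_sum]

theorem trace_mulLeft_matrix {k ι : Type*} [Field k] [Fintype ι] [DecidableEq ι]
    (a : Matrix ι ι k) :
    LinearMap.trace k _ (LinearMap.mulLeft k a) = Fintype.card ι * a.trace := by
  rw [LinearMap.trace_eq_matrix_trace k (Matrix.stdBasis k ι ι), Matrix.trace]
  have : ∀ x : ι × ι, (LinearMap.toMatrix (Matrix.stdBasis k ι ι) (Matrix.stdBasis k ι ι)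
      (LinearMap.mulLeft k a)).diag x = a x.1 x.1 := by
    rintro ⟨i, j⟩
    rw [Matrix.diag_apply, LinearMap.toMatrix_apply, Matrix.stdBasis_eq_single]
    change (a * Matrix.single i j 1 : Matrix ι ι k) i j = a i i
    simp
  rw [Finset.sum_congr rfl fun x _ => this x, Fintype.sum_prod_type, Matrix.trace, Finset.mul_sum]
  simp

/-- The reduced trace of a matrix algebra is the trace. -/
theorem reducedTraceOfSimple_eq_trace {F : Type w} [Field F] [CharZero F] {B : Type v} [Ring B]
    [Algebra F B] {d : ℕ} [NeZero d] (ψ : B ≃ₐ[F] Matrix (Fin d) (Fin d) F) (b : B) :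
    reducedTraceOfSimple F B b = (ψ b).trace := by
  have hB : Nontrivial B := ψ.toEquiv.nontrivial
  have hbij : Function.Bijective (algebraMap F (Subalgebra.center F B)) := by
    refine ⟨(algebraMap F _).injective, fun z => ?_⟩
    have hz : ψ z.1 ∈ Subalgebra.center F (Matrix (Fin d) (Fin d) F) :=
      Subalgebra.mem_center_iff.mpr fun x => by
        have := Subalgebra.mem_center_iff.mp z.2 (ψ.symm x)
        simpa using congrArg ψ this
    obtain ⟨a, ha⟩ := Algebra.mem_bot.mp (Algebra.IsCentral.out hz)
    exact ⟨a, Subtype.ext (ψ.injective ((ψ.commutes a).trans ha))⟩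
  let f : F ≃+* Subalgebra.center F B := RingEquiv.ofBijective _ hbij
  have hf : ∀ a (x : B), f a • x = a • x := fun a x => by
    rw [Algebra.smul_def a x]; rfl
  have hfin : Module.finrank F (Subalgebra.center F B) = 1 := by
    rw [← LinearEquiv.finrank_eq (AlgEquiv.ofBijective (Algebra.ofId F _) hbij).toLinearEquiv,
      Module.finrank_self]
  -- the centre is `F`, so traces over the centre can be computed over `F`
  let β := (Matrix.stdBasis F (Fin d) (Fin d)).map ψ.symm.toLinearEquiv
  let γ : Module.Basis _ (Subalgebra.center F B) B := β.mapCoeffs f hf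
  have hdim : Module.finrank (Subalgebra.center F B) B = d * d := by
    rw [Module.finrank_eq_card_basis γ]; simp
  have htr : LinearMap.trace (Subalgebra.center F B) B (mulLeftOverCenter F B b) =
      f (LinearMap.trace F B (LinearMap.mulLeft F b)) := by
    rw [LinearMap.trace_eq_matrix_trace _ γ, LinearMap.trace_eq_matrix_trace _ β, Matrix.trace,
      Matrix.trace, map_sum]
    refine Finset.sum_congr rfl fun i _ => ?_
    rw [Matrix.diag_apply, Matrix.diag_apply, LinearMap.toMatrix_apply, LinearMap.toMatrix_apply,
      Module.Basis.mapCoeffs_apply]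
    rfl
  have htr' : LinearMap.trace F B (LinearMap.mulLeft F b) = d * (ψ b).trace := by
    have := LinearMap.trace_conj' (LinearMap.mulLeft F b) ψ.toLinearEquiv
    rw [← this]
    have h : ψ.toLinearEquiv.conj (LinearMap.mulLeft F b) = LinearMap.mulLeft F (ψ b) := by
      ext x : 1
      simp [LinearEquiv.conj_apply]
    rw [h, trace_mulLeft_matrix, Fintype.card_fin]
  have hd : (d : F) ≠ 0 := Nat.cast_ne_zero.mpr (NeZero.ne d)
  rw [reducedTraceOfSimple, hdim, Nat.sqrt_eq, htr, htr', map_smul]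
  erw [Algebra.trace_algebraMap]
  rw [hfin]
  simp [hd]

end ReducedTraceMatrix

section Pi
variable {F : Type w} [Field F] {n : ℕ} {d : Fin n → ℕ}

theorem eq_zero_or_one_of_central {d : ℕ} {c : Matrix (Fin d) (Fin d) F} (hc : IsIdempotentElem c)
    (hc' : ∀ a, c * a = a * c) : c = 0 ∨ c = 1 := by
  have : c ∈ Set.center (Matrix (Fin d) (Fin d) F) :=
    Semigroup.mem_center_iff.mpr fun g => (hc' g).symm
  rw [Matrix.center_eq_range] at this
  obtain ⟨a, rfl⟩ := this
  rcases Nat.eq_zero_or_pos d with rfl | hd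
  · exact Or.inl (Subsingleton.elim _ _)
  have ha : a * a = a := by
    have := congrFun (congrFun hc.eq ⟨0, hd⟩) ⟨0, hd⟩
    simpa using this
  rcases IsIdempotentElem.iff_eq_zero_or_one.mp ha with h | h
  · left; simp [h]
  · right; simp [h]

/-- The primitive central idempotents of an algebra isomorphic to a product of matrix algebras are
the units of the factors. -/
theorem isPrimitiveCentralIdempotent_iff [∀ i, NeZero (d i)] {T : Type v} [Ring T]
    (φ : T ≃+* ((i : Fin n) → Matrix (Fin (d i)) (Fin (d i)) F)) (e : T) :
    IsPrimitiveCentralIdempotent e ↔ ∃ i, φ.symm (Pi.single i 1) = e := by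
  have hcent : ∀ c : T, IsIdempotentElem c → (∀ a, c * a = a * c) → ∀ i, φ c i = 0 ∨ φ c i = 1 := by
    intro c hc hc' i
    refine eq_zero_or_one_of_central ?_ fun a => ?_
    · exact congrFun (hc.map φ).eq i
    · have := congrArg (fun x => φ x i) (hc' (φ.symm (Pi.single i a)))
      simpa using this
  have hidem : ∀ i, IsIdempotentElem (φ.symm (Pi.single i 1)) := fun i => by
    rw [IsIdempotentElem, ← map_mul, ← Pi.single_mul, mul_one]
  have hcom : ∀ i a, φ.symm (Pi.single i 1) * a = a * φ.symm (Pi.single i 1) := fun i a => by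
    apply φ.injective
    ext1 j
    rcases eq_or_ne j i with rfl | h
    · simp
    · simp [h]
  have hne : ∀ i, φ.symm (Pi.single i 1) ≠ 0 := fun i h => by
    have := congrArg (fun x => φ x i) h
    simp at this
  constructor
  · intro he
    obtain ⟨i, hi⟩ : ∃ i, φ e i = 1 := by
      by_contra! h
      refine he.ne_zero (φ.injective (funext fun i => ?_))
      rw [map_zero]
      exact (hcent e he.idem he.central i).resolve_right (h i)
    have h1 : φ.symm (Pi.single i 1) * e = φ.symm (Pi.single i 1) := by
      apply φ.injective
      ext1 j
      rcases eq_or_ne j i with rfl | h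
      · simp [hi]
      · simp [h]
    refine ⟨i, ?_⟩
    rcases he.primitive _ (hidem i) (hcom i) with h | h
    · exact absurd (h1.symm.trans h) (hne i)
    · exact h1.symm.trans h
  · rintro ⟨i, rfl⟩
    refine ⟨hidem i, hcom i, hne i, fun c hc hc' => ?_⟩
    have h : ∀ x, φ c i = x → c * φ.symm (Pi.single i 1) = φ.symm (Pi.single i x) := by
      rintro x rfl
      apply φ.injective
      ext1 j
      rcases eq_or_ne j i with rfl | h
      · simp
      · simp [h]
    rcases hcent c hc hc' i with h' | h'
    · left; rw [h _ h']; simp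
    · right; rw [h _ h']

/-- The corner ring at the unit of a factor is this factor. -/
def cornerEquiv {T : Type v} [Ring T] [Algebra F T]
    (φ : T ≃ₐ[F] ((i : Fin n) → Matrix (Fin (d i)) (Fin (d i)) F)) (i : Fin n) {e : T}
    (he : IsIdempotentElem e) (h : φ.symm (Pi.single i 1) = e) :
    he.Corner ≃ₐ[F] Matrix (Fin (d i)) (Fin (d i)) F :=
  have hx : ∀ x : he.Corner, Pi.single i (φ x.1 i) = φ x.1 := by
    intro x
    have h1 := ((Subsemigroup.mem_corner_iff he).mp x.2).1
    have h2 : φ e * φ x.1 = φ x.1 := by rw [← map_mul, h1]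
    have h3 : φ e = Pi.single i 1 := by rw [← h, AlgEquiv.apply_symm_apply]
    rw [h3] at h2
    conv_rhs => rw [← h2]
    ext1 j
    rcases eq_or_ne j i with rfl | h
    · simp
    · simp [h]
  { toFun := fun x => φ x.1 i
    invFun := fun m => ⟨φ.symm (Pi.single i m), φ.symm (Pi.single i m), by
      simp only [← h, ← map_mul, ← Pi.single_mul, one_mul, mul_one]⟩
    left_inv := fun x => Subtype.ext (by
      show φ.symm (Pi.single i (φ x.1 i)) = x.1
      rw [hx, AlgEquiv.symm_apply_apply])
    right_inv := fun m => by simp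
    map_mul' := fun x y => by
      show φ (x.1 * y.1) i = _
      rw [map_mul]; rfl
    map_add' := fun x y => by
      show φ (x.1 + y.1) i = _
      rw [map_add]; rfl
    commutes' := fun r => by
      show φ (r • e) i = _
      rw [map_smul, ← h]
      simp [Algebra.algebraMap_eq_smul_one] }

theorem reducedTrace_eq_sum_trace [CharZero F] [∀ i, NeZero (d i)] {T : Type v} [Ring T]
    [Algebra F T] (φ : T ≃ₐ[F] ((i : Fin n) → Matrix (Fin (d i)) (Fin (d i)) F)) (a : T) :
    reducedTrace F T a = ∑ i, (φ a i).trace := by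
  let g : Fin n → {e : T // IsPrimitiveCentralIdempotent e} := fun i =>
    ⟨φ.symm (Pi.single i 1), (isPrimitiveCentralIdempotent_iff φ.toRingEquiv _).mpr ⟨i, rfl⟩⟩
  have hg : Function.Bijective g := by
    constructor
    · intro i j hij
      have := φ.symm.injective (congrArg Subtype.val hij)
      by_contra hne
      have := congrFun this i
      rw [Pi.single_eq_same, Pi.single_eq_of_ne hne] at this
      exact one_ne_zero this
    · rintro ⟨e, he⟩
      obtain ⟨i, hi⟩ := (isPrimitiveCentralIdempotent_iff φ.toRingEquiv _).mp he
      exact ⟨i, Subtype.ext hi⟩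
  rw [reducedTrace, ← finsum_comp_equiv (Equiv.ofBijective g hg), finsum_eq_sum_of_fintype]
  refine Finset.sum_congr rfl fun i _ => ?_
  refine (reducedTraceOfSimple_eq_trace (cornerEquiv φ i (g i).2.idem rfl) _).trans ?_
  show Matrix.trace (φ (φ.symm (Pi.single i 1) * a * φ.symm (Pi.single i 1)) i) = _
  simp

end Pi

/-- Let `t` be a nondegenerate trace form on a finite-dimensional algebra over an algebraically
closed field of characteristic zero which vanishes on nilpotent elements and has integral values on
idempotents. Then the algebra is semisimple and `t` is the product of the reduced trace with a
central element having integral components. -/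
theorem exists_integral_multiplier {F : Type w} [Field F] [IsAlgClosed F] [CharZero F] {T : Type v}
    [Ring T] [Algebra F T] [FiniteDimensional F T] (t : T →ₗ[F] F)
    (hcomm : ∀ a b, t (a * b) = t (b * a)) (hnd : ∀ a, (∀ b, t (a * b) = 0) → a = 0)
    (hnil : ∀ a, IsNilpotent a → t a = 0) (hidem : ∀ e, IsIdempotentElem e → ∃ m : ℤ, t e = m) :
    ∃ μ : T, (∀ a, t a = reducedTrace F T (μ * a)) ∧
      ∀ e : T, IsPrimitiveCentralIdempotent e → ∃ m : ℤ, μ * e = m • e := by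
  have := IsArtinianRing.of_finite F T
  have : IsSemisimpleRing T := by
    rw [IsArtinianRing.isSemisimpleRing_iff_jacobson, eq_bot_iff]
    intro x hx
    refine hnd x fun b => hnil _ ?_
    -- elements of the Jacobson radical generate nilpotent right ideals
    obtain ⟨N, hN⟩ := IsSemiprimaryRing.isNilpotent (R := T)
    refine ⟨N, ?_⟩
    have := Ideal.pow_mem_pow (Ideal.mul_mem_right b _ hx) N
    rwa [hN] at this
  obtain ⟨n, d, hd, ⟨φ⟩⟩ := IsSemisimpleRing.exists_algEquiv_pi_matrix_of_isAlgClosed F T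
  let τ : ∀ i, Matrix (Fin (d i)) (Fin (d i)) F →ₗ[F] F := fun i =>
    t ∘ₗ φ.symm.toLinearMap ∘ₗ LinearMap.single F (fun i => Matrix (Fin (d i)) (Fin (d i)) F) i
  have hτ : ∀ i, ∃ m : ℤ, ∀ a, τ i a = m * a.trace := by
    intro i
    -- the multiple is the value at an idempotent of rank one
    obtain ⟨m, hm⟩ := hidem (φ.symm (Pi.single i (Matrix.single 0 0 1))) (by
      rw [IsIdempotentElem, ← map_mul, ← Pi.single_mul]; simp)
    refine ⟨m, fun a => ?_⟩
    rw [eq_mul_trace_of_mul_comm (τ i) (fun a b => ?_) 0 a]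
    · exact congrArg (· * _) hm
    · simp only [τ, LinearMap.comp_apply, LinearMap.single_apply, Pi.single_mul,
        AlgEquiv.toLinearMap_apply, map_mul, hcomm]
  choose m hm using hτ
  refine ⟨φ.symm fun i => (m i : Matrix (Fin (d i)) (Fin (d i)) F), fun a => ?_, fun e he => ?_⟩
  · rw [reducedTrace_eq_sum_trace φ]
    have : a = ∑ i, φ.symm (Pi.single i (φ a i)) := by
      apply φ.injective
      rw [map_sum]
      simp [Finset.univ_sum_single]
    conv_lhs => rw [this, map_sum]
    refine Finset.sum_congr rfl fun i _ => (hm i (φ a i)).trans ?_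
    simp [← zsmul_eq_mul]
  · obtain ⟨i, rfl⟩ := (isPrimitiveCentralIdempotent_iff φ.toRingEquiv e).mp he
    refine ⟨m i, φ.injective ?_⟩
    ext1 j
    rcases eq_or_ne j i with rfl | h
    · simp
    · simp [h]

/-! ### The trace form of a rigid category -/

namespace NumQuotient
variable {C : Type u} [Category.{v} C] [MonoidalCategory C] [SymmetricCategory C]
  [LeftRigidCategory C] [Preadditive C] [MonoidalPreadditive C]

/-- The projection `C ⥤ C/N` is strictly monoidal. -/
instance : (proj : C ⥤ NumQuotient C).Monoidal :=
  Functor.CoreMonoidal.toMonoidal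
    { εIso := Iso.refl _
      μIso := fun _ _ => Iso.refl _
      μIso_hom_natural_left := fun f X => by
        simp only [Iso.refl_hom, Category.comp_id, Category.id_comp]; rfl
      μIso_hom_natural_right := fun X f => by
        simp only [Iso.refl_hom, Category.comp_id, Category.id_comp]; rfl
      associativity := fun X Y Z => congrArg proj.map
        (show 𝟙 (X ⊗ Y) ▷ Z ≫ 𝟙 _ ≫ (α_ X Y Z).hom = (α_ X Y Z).hom ≫ X ◁ 𝟙 (Y ⊗ Z) ≫ 𝟙 _ by simp)
      left_unitality := fun X => congrArg proj.map
        (show (λ_ X).hom = 𝟙 (𝟙_ C) ▷ X ≫ 𝟙 _ ≫ (λ_ X).hom by simp)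
      right_unitality := fun X => congrArg proj.map
        (show (ρ_ X).hom = X ◁ 𝟙 (𝟙_ C) ≫ 𝟙 _ ≫ (ρ_ X).hom by simp) }

instance : (proj : C ⥤ NumQuotient C).Braided where
  braided _ _ := (Category.id_comp _).trans (Category.comp_id _).symm

end NumQuotient

section TraceLinear
variable {C : Type u} [Category.{v} C] [MonoidalCategory C] [SymmetricCategory C]
  [LeftRigidCategory C] [Preadditive C] [MonoidalPreadditive C]

theorem trace_add {X : C} (f g : X ⟶ X) : trace (f + g) = trace f + trace g := by
  simp only [trace, MonoidalPreadditive.whiskerLeft_add, Preadditive.comp_add,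
    Preadditive.add_comp]

theorem trace_smul {K : Type w} [Field K] [Linear K C] [MonoidalLinear K C] (r : K) {X : C}
    (f : X ⟶ X) : trace (r • f) = r • trace f := by
  simp only [trace, MonoidalLinear.whiskerLeft_smul, Linear.comp_smul, Linear.smul_comp]

end TraceLinear

namespace RigidCat

variable {K : Type w} [Field K] (A : RigidCat.{v, u} K)

variable {A} in
/-- The trace of endomorphisms of `M`, with values in `K`. -/
def scalarTrace (M : A) : End M →ₗ[K] K :=
  (LinearEquiv.ofBijective (Algebra.linearMap K (End (𝟙_ A))) A.end_unit).symm.toLinearMap ∘ₗ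
  { toFun := fun f => trace f
    map_add' := fun f g => trace_add (X := M) f g
    map_smul' := fun r f => trace_smul r (X := M) f }

variable {A}

theorem scalarTrace_smul_id {M : A} (f : End M) : scalarTrace M f • 𝟙 (𝟙_ A) = trace f := by
  have := (LinearEquiv.ofBijective (Algebra.linearMap K (End (𝟙_ A))) A.end_unit).apply_symm_apply
    (trace f)
  refine Eq.trans ?_ this
  exact (Algebra.algebraMap_eq_smul_one (R := K) (A := End (𝟙_ A)) _).symm

theorem scalarTrace_eq_iff {M : A} (f : End M) (r : K) :
    scalarTrace M f = r ↔ trace f = r • 𝟙 (𝟙_ A) := by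
  rw [← scalarTrace_smul_id]
  refine ⟨fun h => by rw [h], fun h => A.end_unit.1 ?_⟩
  rw [Algebra.algebraMap_eq_smul_one, Algebra.algebraMap_eq_smul_one]
  exact h

theorem scalarTrace_comp_comm {M N : A} (f : M ⟶ N) (g : N ⟶ M) :
    scalarTrace M (f ≫ g : M ⟶ M) = scalarTrace N (g ≫ f : N ⟶ N) := by
  rw [scalarTrace_eq_iff, scalarTrace_smul_id]
  exact pairingTrace_comp_comm _ _ f g

theorem scalarTrace_mul_comm {M : A} (f g : End M) :
    scalarTrace M (f * g) = scalarTrace M (g * f) :=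
  scalarTrace_comp_comm g f

variable {B : RigidCat.{v', u'} K}

theorem scalarTrace_map (F : B ⥤ A) [F.Additive] [F.Linear K] [F.Braided] {N : B} (f : N ⟶ N) :
    scalarTrace (F.obj N) (F.map f) = scalarTrace N f := by
  let _ := mapExactPairing F (ᘁN) N
  rw [scalarTrace_eq_iff]
  have h := pairingTrace_map F (ᘁN) f
  have h' : pairingTrace (ᘁN) f = scalarTrace N f • 𝟙 (𝟙_ B) := (scalarTrace_smul_id f).symm
  rw [h'] at h
  have h'' := pairingTrace_comp_comm (ᘁ(F.obj N)) (F.obj (ᘁN)) (F.map f) (𝟙 (F.obj N))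
  rw [Category.comp_id, Category.id_comp, h] at h''
  refine h''.trans ?_
  simp

section Homological

variable {L : Type w'} [Field L] [Algebra K L] (H : B ⥤ SuperVect L)

theorem algebraMap_scalarTrace [H.Braided]
    (hH : ∀ (X Y : B) (r : K) (f : X ⟶ Y), H.map (r • f) = algebraMap K L r • H.map f)
    {N : B} (f : N ⟶ N) :
    algebraMap K L (scalarTrace N f) = LinearMap.trace L _ (H.map f).even -
      LinearMap.trace L _ (H.map f).odd := by
  let _ := mapExactPairing H (ᘁN) N
  rw [← SuperVect.pairingTrace_even (H.obj (ᘁN))]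
  have h := pairingTrace_map H (ᘁN) f
  have h' : pairingTrace (ᘁN) f = scalarTrace N f • 𝟙 (𝟙_ B) := (scalarTrace_smul_id f).symm
  rw [h', hH, H.map_id] at h
  have h'' : pairingTrace (H.obj (ᘁN)) (H.map f) =
    algebraMap K L (scalarTrace N f) • 𝟙 (𝟙_ (SuperVect L)) := by
    rw [h]; simp
  rw [h'']
  exact (mul_one _).symm

/-- The action of the endomorphisms of `N` on the two parts of `H N`, in matrix form. -/
theorem exists_matrix_realization [H.Additive] [H.Braided]
    (hH : ∀ (X Y : B) (r : K) (f : X ⟶ Y), H.map (r • f) = algebraMap K L r • H.map f) (N : B) :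
    ∃ (Φ₀ : End N →ₐ[K] Matrix (Fin (Module.finrank L (H.obj N).even))
        (Fin (Module.finrank L (H.obj N).even)) L)
      (Φ₁ : End N →ₐ[K] Matrix (Fin (Module.finrank L (H.obj N).odd))
        (Fin (Module.finrank L (H.obj N).odd)) L),
      ∀ f, algebraMap K L (scalarTrace N f) = (Φ₀ f).trace - (Φ₁ f).trace := by
  let b₀ := Module.finBasis L (H.obj N).even
  let b₁ := Module.finBasis L (H.obj N).odd
  let Φ₀ : End N →+* Matrix (Fin (Module.finrank L (H.obj N).even))
        (Fin (Module.finrank L (H.obj N).even)) L :=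
    { toFun := fun f => LinearMap.toMatrixAlgEquiv b₀ (H.map f).even
      map_one' := by
        rw [End.one_def, H.map_id]; exact map_one (LinearMap.toMatrixAlgEquiv b₀)
      map_mul' := fun f g => by
        rw [End.mul_def, H.map_comp]; exact map_mul (LinearMap.toMatrixAlgEquiv b₀) _ _
      map_zero' := by
        rw [H.map_zero]; exact map_zero (LinearMap.toMatrixAlgEquiv b₀)
      map_add' := fun f g => by
        rw [H.map_add]; exact map_add (LinearMap.toMatrixAlgEquiv b₀) _ _ }
  let Φ₁ : End N →+* Matrix (Fin (Module.finrank L (H.obj N).odd))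
        (Fin (Module.finrank L (H.obj N).odd)) L :=
    { toFun := fun f => LinearMap.toMatrixAlgEquiv b₁ (H.map f).odd
      map_one' := by
        rw [End.one_def, H.map_id]; exact map_one (LinearMap.toMatrixAlgEquiv b₁)
      map_mul' := fun f g => by
        rw [End.mul_def, H.map_comp]; exact map_mul (LinearMap.toMatrixAlgEquiv b₁) _ _
      map_zero' := by
        rw [H.map_zero]; exact map_zero (LinearMap.toMatrixAlgEquiv b₁)
      map_add' := fun f g => by
        rw [H.map_add]; exact map_add (LinearMap.toMatrixAlgEquiv b₁) _ _ }
  have hr : ∀ r : K, H.map (algebraMap K (End N) r : N ⟶ N) = algebraMap K L r • 𝟙 _ := fun r => by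
    rw [← H.map_id, ← hH, Algebra.algebraMap_eq_smul_one]; rfl
  refine ⟨{ Φ₀ with commutes' := fun r => ?_ }, { Φ₁ with commutes' := fun r => ?_ }, fun f => ?_⟩
  · change LinearMap.toMatrixAlgEquiv b₀ (H.map (algebraMap K (End N) r : N ⟶ N)).even = _
    rw [hr, SuperVect.smul_even, map_smul]
    refine (congrArg (_ • ·) (map_one (LinearMap.toMatrixAlgEquiv b₀))).trans ?_
    rw [← Algebra.algebraMap_eq_smul_one, ← IsScalarTower.algebraMap_apply]
  · change LinearMap.toMatrixAlgEquiv b₁ (H.map (algebraMap K (End N) r : N ⟶ N)).odd = _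
    rw [hr, SuperVect.smul_odd, map_smul]
    refine (congrArg (_ • ·) (map_one (LinearMap.toMatrixAlgEquiv b₁))).trans ?_
    rw [← Algebra.algebraMap_eq_smul_one, ← IsScalarTower.algebraMap_apply]
  · rw [algebraMap_scalarTrace H hH, LinearMap.trace_eq_matrix_trace L b₀,
      LinearMap.trace_eq_matrix_trace L b₁]
    rfl

end Homological

end RigidCat

/-! ### Endomorphism algebras in the quotient category -/

section TensorPow

variable {C : Type u} [Category.{v} C] [MonoidalCategory C]
  {D : Type u'} [Category.{v'} D] [MonoidalCategory D]

/-- A monoidal functor mapping `N` to `M` maps the powers of `N` to those of `M`. -/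
theorem nonempty_map_tensorPow_iso (F : C ⥤ D) [F.Monoidal] {N : C} {M : D} (i : F.obj N ≅ M)
    (n : ℕ) : Nonempty (F.obj (tensorPow N n) ≅ tensorPow M n) := by
  induction n with
  | zero => exact ⟨(Functor.Monoidal.εIso F).symm⟩
  | succ n ih => exact ih.map fun j =>
      (Functor.Monoidal.μIso F N (tensorPow N n)).symm ≪≫ (i ⊗ᵢ j)

end TensorPow

namespace SuperVect

variable {L : Type w} [Field L]

/-- The total dimension of a super vector space. -/
def totalDim (V : SuperVect L) : ℕ := Module.finrank L V.even + Module.finrank L V.odd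

theorem totalDim_congr {V W : SuperVect L} (i : V ≅ W) : totalDim V = totalDim W := by
  have h₀ : V.even ≃ₗ[L] W.even := LinearEquiv.ofLinearMap i.hom.even i.inv.even
    (congrArg Hom.even i.inv_hom_id) (congrArg Hom.even i.hom_inv_id)
  have h₁ : V.odd ≃ₗ[L] W.odd := LinearEquiv.ofLinearMap i.hom.odd i.inv.odd
    (congrArg Hom.odd i.inv_hom_id) (congrArg Hom.odd i.hom_inv_id)
  rw [totalDim, totalDim, h₀.finrank_eq, h₁.finrank_eq]

theorem totalDim_tensorPow (V : SuperVect L) (n : ℕ) :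
    totalDim (tensorPow V n) = totalDim V ^ n := by
  induction n with
  | zero =>
    change Module.finrank L L + Module.finrank L PUnit.{w + 1} = 1
    rw [Module.finrank_self, Module.finrank_zero_of_subsingleton]
  | succ n ih =>
    rw [pow_succ', ← ih]
    change Module.finrank L (TensorProduct L V.even (tensorPow V n).even ×
        TensorProduct L V.odd (tensorPow V n).odd) +
      Module.finrank L (TensorProduct L V.even (tensorPow V n).odd ×
        TensorProduct L V.odd (tensorPow V n).even) = _
    simp only [Module.finrank_prod, Module.finrank_tensorProduct, totalDim]
    ring

end SuperVect

namespace RigidCat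

variable {K : Type w} [Field K] {A : RigidCat.{v, u} K} {B : RigidCat.{v', u'} K}
  (E : NumQuotient B ⥤ A)

theorem proj_map_eq_zero {N N' : B} {f : N ⟶ N'} (hf : UniversallyTraceZero f) :
    (NumQuotient.proj : B ⥤ NumQuotient B).map f = 0 := by
  rw [← Functor.map_zero (NumQuotient.proj : B ⥤ NumQuotient B)]
  exact CategoryTheory.Quotient.sound (negRel B) (by simpa [negRel] using hf)

instance : (NumQuotient.proj : B ⥤ NumQuotient B).Linear K :=
  CategoryTheory.Quotient.linear_functor ..

/-- The action of `End N` on an object of `A` isomorphic to the image of `N`. -/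
def projEnd [E.Additive] [E.Linear K] {N : B} {M : A} (i : (NumQuotient.proj ⋙ E).obj N ≅ M) :
    End N →ₐ[K] End M where
  toFun f := i.inv ≫ (NumQuotient.proj ⋙ E).map f ≫ i.hom
  map_one' := by
    rw [End.one_def, CategoryTheory.Functor.map_id, Category.id_comp, i.inv_hom_id]; rfl
  map_mul' f g := by
    rw [End.mul_def, End.mul_def, Functor.map_comp]; simp
  map_zero' := by
    rw [Functor.map_zero]; simp
  map_add' f g := by
    rw [Functor.map_add]; simp
  commutes' r := by
    rw [Algebra.algebraMap_eq_smul_one, Algebra.algebraMap_eq_smul_one]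
    refine (congrArg (fun x => i.inv ≫ x ≫ i.hom)
      (CategoryTheory.Functor.map_smul (NumQuotient.proj ⋙ E) r (𝟙 N))).trans ?_
    rw [CategoryTheory.Functor.map_id, Linear.smul_comp, Linear.comp_smul, Category.id_comp,
      i.inv_hom_id]
    rfl

section
variable [E.Additive] [E.Linear K] {N : B} {M : A} (i : (NumQuotient.proj ⋙ E).obj N ≅ M)

theorem projEnd_surjective [E.Full] : Function.Surjective (projEnd E i) := fun f => by
  obtain ⟨g, hg⟩ := (NumQuotient.proj ⋙ E).map_surjective (i.hom ≫ f ≫ i.inv)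
  refine ⟨g, ?_⟩
  change i.inv ≫ (NumQuotient.proj ⋙ E).map g ≫ i.hom = f
  rw [hg]; simp

theorem scalarTrace_projEnd [E.Braided] (f : End N) :
    scalarTrace M (projEnd E i f) = scalarTrace N f := by
  rw [← scalarTrace_map (NumQuotient.proj ⋙ E) f]
  refine (scalarTrace_comp_comm i.inv ((NumQuotient.proj ⋙ E).map f ≫ i.hom)).trans ?_
  rw [Category.assoc, i.hom_inv_id, Category.comp_id]

/-- In a category equivalent to the quotient by the morphisms universally of trace zero, the trace
form is nondegenerate. -/
theorem eq_zero_of_scalarTrace_mul (E : NumQuotient B ⥤ A) [E.Additive] [E.Linear K] [E.Full]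
    [E.Braided] {N : B} {M : A} (i : (NumQuotient.proj ⋙ E).obj N ≅ M) (f : End M)
    (hf : ∀ g, scalarTrace M (f * g) = 0) : f = 0 := by
  obtain ⟨f, rfl⟩ := projEnd_surjective E i f
  have h : UniversallyTraceZero (f : N ⟶ N) := fun g => by
    have := hf (projEnd E i g)
    rw [scalarTrace_mul_comm, ← map_mul, scalarTrace_projEnd, scalarTrace_eq_iff, zero_smul] at this
    exact this
  change i.inv ≫ E.map ((NumQuotient.proj : B ⥤ NumQuotient B).map f) ≫ i.hom = 0
  rw [proj_map_eq_zero h]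
  simp

end

/-- The rank of `End M` is bounded in terms of the dimension of a super vector space attached to
`M`. -/
theorem card_le_of_linearIndependent (E : NumQuotient B ⥤ A) [E.Additive] [E.Linear K] [E.Full]
    [E.Braided] {N : B} {M : A} (i : (NumQuotient.proj ⋙ E).obj N ≅ M)
    {L : Type w'} [Field L] [Algebra K L] (H : B ⥤ SuperVect L) [H.Additive] [H.Braided]
    (hH : ∀ (X Y : B) (r : K) (f : X ⟶ Y), H.map (r • f) = algebraMap K L r • H.map f)
    {ι : Type*} [Fintype ι] {s : ι → End M}
    (hs : LinearIndependent K s) : Fintype.card ι ≤ (H.obj N).totalDim ^ 2 := by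
  obtain ⟨Φ₀, Φ₁, hΦ⟩ := exists_matrix_realization H hH N
  choose r hr using fun k => projEnd_surjective E i (s k)
  let θ : Matrix (Fin (Module.finrank L (H.obj N).even)) (Fin (Module.finrank L (H.obj N).even)) L ×
      Matrix (Fin (Module.finrank L (H.obj N).odd)) (Fin (Module.finrank L (H.obj N).odd)) L →ₗ[L]
      L := Matrix.traceLinearMap _ L L ∘ₗ LinearMap.fst L _ _ -
        Matrix.traceLinearMap _ L L ∘ₗ LinearMap.snd L _ _
  have h := linearIndependent_of_realization (projEnd E i).toRingHom (projEnd_surjective E i)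
    (scalarTrace M) (eq_zero_of_scalarTrace_mul E i) (Φ₀.prod Φ₁).toRingHom θ
    (fun r => ((hΦ r).symm.trans (congrArg _ (scalarTrace_projEnd E i r).symm))) (r := r)
    (by
      have : (projEnd E i).toRingHom ∘ r = s := funext hr
      rw [this]
      exact hs)
  refine h.fintype_card_le_finrank.trans ?_
  simp only [Module.finrank_prod, Module.finrank_matrix, Module.finrank_self, Fintype.card_fin,
    SuperVect.totalDim, mul_one]
  nlinarith [Nat.zero_le (Module.finrank L (H.obj N).even * Module.finrank L (H.obj N).odd)]

end RigidCat

/-! ### Schur-finiteness and integrality -/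

section Schur

theorem exists_isIdempotentElem_mem_isSimpleModule {R : Type*} [Ring R] [IsSemisimpleRing R]
    {I : Ideal R} (hI : I ≠ ⊥) :
    ∃ e ∈ I, IsIdempotentElem e ∧ IsSimpleModule R (Submodule.span R {e}) := by
  obtain ⟨J, hJ, hJI⟩ := (eq_bot_or_exists_atom_le I).resolve_left hI
  obtain ⟨e, he, rfl⟩ := IsSemisimpleRing.ideal_eq_span_idempotent J
  exact ⟨e, hJI (Ideal.subset_span rfl), he, isSimpleModule_iff_isAtom.mpr hJ⟩

theorem linearIndependent_comp_single {K G S : Type*} [Field K] [Monoid G] [Ring S] [Algebra K S]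
    {φ : MonoidAlgebra K G →ₐ[K] S} (hφ : Function.Injective φ) :
    LinearIndependent K fun g => φ (MonoidAlgebra.single g 1) := by
  have h : LinearIndependent K fun g : G => (MonoidAlgebra.single g 1 : MonoidAlgebra K G) :=
    (Finsupp.linearIndependent_single_one K G).map'
      (MonoidAlgebra.coeffLinearEquiv K).symm.toLinearMap (LinearEquiv.ker _)
  exact h.map_injOn φ.toLinearMap hφ.injOn

/-- If the action of `K[𝔖_n]` on `M^{⊗ n}` is not faithful, its kernel contains a simple left ideal,
which defines a Schur functor killing `M`. -/
theorem schurFinite_of_not_injective {K : Type w} [Field K] [CharZero K] {C : Type u}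
    [Category.{v} C] [MonoidalCategory C] [SymmetricCategory C] [Preadditive C] [Linear K C]
    {M : C} {n : ℕ} (h : ¬ Function.Injective (groupAlgebraAction K M n)) : SchurFinite K M := by
  have : NeZero ((Nat.card (Equiv.Perm (Fin n)) : ℕ) : K) := ⟨by simp⟩
  let I : Ideal (MonoidAlgebra K (Equiv.Perm (Fin n))) :=
    RingHom.ker (groupAlgebraAction K M n).toRingHom
  have hI : I ≠ ⊥ := fun hI => h ((RingHom.injective_iff_ker_eq_bot _).mpr hI)
  obtain ⟨e, heI, he, hs⟩ := exists_isIdempotentElem_mem_isSimpleModule hI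
  refine ⟨n, e, he, hs, ?_⟩
  rw [Limits.IsZero.iff_id_eq_zero]
  apply Idempotents.Karoubi.hom_ext
  exact heI

theorem exists_pow_lt_factorial (d : ℕ) : ∃ n : ℕ, d ^ n < n.factorial := by
  obtain ⟨n, hn⟩ := ((FloorSemiring.tendsto_pow_div_factorial_atTop (d : ℝ)).eventually
    (gt_mem_nhds one_pos)).exists
  refine ⟨n, ?_⟩
  rw [div_lt_one (by positivity)] at hn
  exact_mod_cast hn

end Schur

namespace RigidCat

variable {K : Type w} [Field K] {A : RigidCat.{v, u} K} {B : RigidCat.{v', u'} K}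

/-- The endomorphisms of `M^{⊗ n}` span a space whose dimension grows at most exponentially
with `n`, while the group algebra of `𝔖_n` has dimension `n!`. -/
theorem schurFinite_of_realization [CharZero K] (E : NumQuotient B ⥤ A) [E.Additive] [E.Linear K]
    [E.IsEquivalence] [E.Braided] {L : Type w'} [Field L] [Algebra K L] (H : B ⥤ SuperVect L)
    [H.Additive] [H.Braided]
    (hH : ∀ (X Y : B) (r : K) (f : X ⟶ Y), H.map (r • f) = algebraMap K L r • H.map f)
    {N : B} {M : A} (i : (NumQuotient.proj ⋙ E).obj N ≅ M) : SchurFinite K M := by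
  obtain ⟨n, hn⟩ := exists_pow_lt_factorial ((H.obj N).totalDim ^ 2)
  refine schurFinite_of_not_injective (n := n) fun hinj => hn.not_ge ?_
  obtain ⟨j⟩ := nonempty_map_tensorPow_iso (NumQuotient.proj ⋙ E) i n
  obtain ⟨k⟩ := nonempty_map_tensorPow_iso H (Iso.refl (H.obj N)) n
  have hs := linearIndependent_comp_single hinj
  have h := card_le_of_linearIndependent E j H hH hs
  rw [Fintype.card_perm, Fintype.card_fin, SuperVect.totalDim_congr k,
    SuperVect.totalDim_tensorPow] at h
  rwa [← pow_mul, mul_comm, pow_mul]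

section Integral

open TensorProduct

variable (F : Type w') [Field F] [Algebra K F]

/-- The endomorphism ring of an object after extension of scalars. -/
def endScalarExtEquiv (M : A) : F ⊗[K] End M ≃ₐ[F] End (⟨M⟩ : ScalarExt K F A) :=
  AlgEquiv.ofLinearEquiv (LinearEquiv.refl F (F ⊗[K] (M ⟶ M))) rfl fun x y => by
    induction x using TensorProduct.induction_on with
    | zero => rw [zero_mul, map_zero]; exact (zero_mul _).symm
    | add x x' hx hx' =>
      rw [add_mul, map_add, hx, hx', map_add, add_mul]
    | tmul a f =>
      induction y using TensorProduct.induction_on with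
      | zero => rw [mul_zero, map_zero]; exact (mul_zero _).symm
      | add y y' hy hy' => rw [mul_add, map_add, hy, hy', map_add, mul_add]
      | tmul b g =>
        rw [Algebra.TensorProduct.tmul_mul_tmul, mul_comm]
        exact (ScalarExt.homMk_comp _ _ _ _).symm

theorem trace_endScalarExtEquiv {M : A} (x : F ⊗[K] End M) :
    trace (endScalarExtEquiv F M x) =
      algebraMap F (End (𝟙_ (ScalarExt K F A))) (extendForm F (scalarTrace M) x) := by
  induction x using TensorProduct.induction_on with
  | zero =>
    rw [map_zero, map_zero, map_zero]
    exact (trace_smul (0 : F) (0 : (⟨M⟩ : ScalarExt K F A) ⟶ ⟨M⟩))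
  | add x y hx hy =>
    rw [map_add, map_add, map_add, ← hx, ← hy]
    exact trace_add (C := ScalarExt K F A) _ _
  | tmul a f =>
    have h : trace (endScalarExtEquiv F M (a ⊗ₜ f)) =
        (ScalarExt.homMk a (trace (f : M ⟶ M)) : 𝟙_ (ScalarExt K F A) ⟶ 𝟙_ (ScalarExt K F A)) := by
      change (ScalarExt.homMk 1 (η_ (ᘁM) M) :
          𝟙_ (ScalarExt K F A) ⟶ (⟨(ᘁM) ⊗ M⟩ : ScalarExt K F A)) ≫
        (ScalarExt.homMk a ((ᘁM) ◁ (f : M ⟶ M)) :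
          (⟨(ᘁM) ⊗ M⟩ : ScalarExt K F A) ⟶ (⟨(ᘁM) ⊗ M⟩ : ScalarExt K F A)) ≫
        (ScalarExt.homMk 1 (β_ (ᘁM) M).hom :
          (⟨(ᘁM) ⊗ M⟩ : ScalarExt K F A) ⟶ (⟨M ⊗ (ᘁM)⟩ : ScalarExt K F A)) ≫
        (ScalarExt.homMk 1 (ε_ (ᘁM) M) :
          (⟨M ⊗ (ᘁM)⟩ : ScalarExt K F A) ⟶ 𝟙_ (ScalarExt K F A)) = _
      rw [ScalarExt.homMk_comp, ScalarExt.homMk_comp, ScalarExt.homMk_comp, one_mul, mul_one,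
        mul_one]
      rfl
    rw [h, extendForm_tmul, ← scalarTrace_smul_id, Algebra.algebraMap_eq_smul_one]
    refine (TensorProduct.smul_tmul _ a (𝟙 (𝟙_ A))).symm.trans ?_
    exact (congrArg (fun b => ScalarExt.homMk b (𝟙 (𝟙_ A))) (mul_one _)).symm

/-- The trace form of `A` being realized by supertraces, it satisfies the assumptions of
`exists_integral_multiplier` after extension of scalars. -/
theorem exists_integral_multiplier_of_realization {F : Type w} [Field F] [Algebra K F]
    [IsAlgClosed F] [Algebra.IsAlgebraic K F] [CharZero F]
    (E : NumQuotient B ⥤ A) [E.Additive] [E.Linear K]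
    [E.IsEquivalence] [E.Braided] {L : Type w'} [Field L] [Algebra K L] (H : B ⥤ SuperVect L)
    [H.Additive] [H.Braided]
    (hH : ∀ (X Y : B) (r : K) (f : X ⟶ Y), H.map (r • f) = algebraMap K L r • H.map f)
    {N : B} {M : A} (i : (NumQuotient.proj ⋙ E).obj N ≅ M) :
    ∃ μ : End (⟨M⟩ : ScalarExt K F A),
      (∀ f : End (⟨M⟩ : ScalarExt K F A),
        trace f = algebraMap F (End (𝟙_ (ScalarExt K F A))) (reducedTrace F _ (μ * f))) ∧
      ∀ e : End (⟨M⟩ : ScalarExt K F A), IsPrimitiveCentralIdempotent e →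
        ∃ m : ℤ, μ * e = m • e := by
  let θ := endScalarExtEquiv F M
  -- a field containing both `L`, where the supertraces live, and `F`
  let j : L →ₐ[K] AlgebraicClosure L := IsScalarTower.toAlgHom K L (AlgebraicClosure L)
  let k : F →ₐ[K] AlgebraicClosure L := IsAlgClosed.lift
  obtain ⟨Φ₀, Φ₁, hΦ⟩ := exists_matrix_realization H hH N
  have hr : ∀ r, algebraMap K (AlgebraicClosure L) (scalarTrace M (projEnd E i r)) =
      ((j.mapMatrix.comp Φ₀) r).trace - ((j.mapMatrix.comp Φ₁) r).trace := by
    intro r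
    rw [scalarTrace_projEnd, IsScalarTower.algebraMap_apply K L, hΦ, map_sub]
    exact congrArg₂ (· - ·) (by simp [Matrix.trace, j]) (by simp [Matrix.trace, j])
  have : FiniteDimensional K (End M) := by
    have h : Module.rank K (End M) ≤ ((H.obj N).totalDim ^ 2 : ℕ) :=
      rank_le fun s hs => by
        simpa using card_le_of_linearIndependent E i H hH hs
    exact Module.rank_lt_aleph0_iff.mp (h.trans_lt (Cardinal.natCast_lt_aleph0))
  have : FiniteDimensional F (End (⟨M⟩ : ScalarExt K F A)) :=
    Module.Finite.equiv θ.toLinearEquiv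
  obtain ⟨μ, hμ, hμ'⟩ := exists_integral_multiplier
    (extendForm F (scalarTrace M) ∘ₗ θ.symm.toLinearMap)
    (fun a b => by
      simpa only [LinearMap.comp_apply, AlgEquiv.toLinearMap_apply, map_mul] using
        extendForm_mul_comm scalarTrace_mul_comm (θ.symm a) (θ.symm b))
    (fun a ha => by
      apply θ.symm.injective
      rw [map_zero]
      refine extendForm_nondegenerate (eq_zero_of_scalarTrace_mul E i) _ fun y => ?_
      simpa only [LinearMap.comp_apply, AlgEquiv.toLinearMap_apply, map_mul,
        AlgEquiv.symm_apply_apply] using ha (θ y))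
    (fun a ha => extendForm_eq_zero_of_isNilpotent k (projEnd_surjective E i) hr
      (ha.map θ.symm))
    (fun e he => exists_extendForm_eq_intCast k (projEnd_surjective E i) hr
      (he.map θ.symm))
  refine ⟨μ, fun f => ?_, hμ'⟩
  rw [← hμ]
  have := trace_endScalarExtEquiv F (θ.symm f)
  rwa [AlgEquiv.apply_symm_apply] at this

end Integral

end RigidCat

end TensorCat

end

theorem theorem2 {K : Type w} [Field K] [CharZero K] (A : TensorCat.RigidCat.{v, u} K)
    (hA : TensorCat.RigidCat.IsOfHomologicalOrigin.{v, u, w, w', v', u'} A) :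
    (∀ M : A, TensorCat.SchurFinite K M) ∧ A.IsGeometricallyOfIntegralType := by
  obtain ⟨-, B, ⟨L, _, _, H, _, hH, ⟨_⟩⟩, E, _, _, _, ⟨_⟩⟩ := hA
  have hM : ∀ M : A, ∃ N : B, Nonempty ((TensorCat.NumQuotient.proj ⋙ E).obj N ≅ M) := fun M =>
    ⟨(E.objPreimage M).as, ⟨E.objObjPreimageIso M⟩⟩
  refine ⟨fun M => ?_, fun M => ?_⟩
  · obtain ⟨N, ⟨i⟩⟩ := hM M
    exact TensorCat.RigidCat.schurFinite_of_realization E H hH i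
  · obtain ⟨N, ⟨i⟩⟩ := hM M
    exact TensorCat.RigidCat.exists_integral_multiplier_of_realization E H hH i
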